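/- Let $n\ge 1$ and let $\Sigma\subset\mathbb R^n$ be a compact connected embedded hypersurface of class $C^2$ which is the boundary $\Sigma=\partial\Omega$ of a bounded domain $\Omega\subset\mathbb R^n$. Thus near each $p\in\Sigma$ there is a $C^2$-diffeomorphism $\Phi$ between open neighborhoods of $p$ and of $0=\Phi(p)$ that maps $\Sigma$ onto $\mathbb R^{n-1}\times\{0\}$ (inside these neighborhoods). With the local parametrization $\phi(\theta)=\Phi^{-1}(\theta,0)$ put, at $p=\phi(0)$, $\tau_i=\partial_i\phi$, $\tau_{ij}=\partial_i\partial_j\phi$, $g_{ij}=(\tau_i|\tau_j)$, $[g^{ij}]=[g_{ij}]^{-1}$, $\tau^i=g^{ik}\tau_k$ (repeated indices are summed). Let $\nu_\Sigma$ be the outer unit normal field on $\Sigma$ with respect to $\Omega$, and let $l_{ij}=(\tau_{ij}|\nu_\Sigma)$. The principal curvatures $\kappa_1,\dots,\kappa_{n-1}$ at $p$ are the eigenvalues, with multiplicity, of the matrix $K=[g^{ir}l_{rj}]$, $\kappa_\Sigma=\operatorname{tr}K$ is the mean curvature, $L_\Sigma=l_{ij}\,\tau^i\otimes\tau^j$ is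 the Weingarten tensor (where $(a\otimes b)x=(b|x)a$), $P_\Sigma=I-\nu_\Sigma\otimes\nu_\Sigma$, and $M_0(r)=(I-rL_\Sigma)^{-1}$. Say that $\Sigma$ satisfies the ball condition with radius $a>0$ if for each $p\in\Sigma$ there are an open ball of radius $a$ contained in $\Omega$ and one contained in $\mathbb R^n\setminus\overline\Omega$, the closure of each of which meets $\Sigma$ exactly in $p$. Let $d_\Sigma$ be the signed distance to $\Sigma$, i.e. $|d_\Sigma(x)|=\operatorname{dist}(x,\Sigma)$ with $d_\Sigma<0$ exactly in $\Omega$. Then $\nu_\Sigma$ exists at every point of $\Sigma$, and the ball condition holds for some $a>0$. Moreover, for every $a>0$ for which it holds: (a) The map $X(p,r)=p+r\nu_\Sigma(p)$ is injective on $\Sigma\times(-a,a)$. Its image $U_a$ is open and equals $\{x:\operatorname{dist}(x,\Sigma)<a\}$. Every $x\in U_a$ has a unique nearest point $\Pi_\Sigma(x)$ on $\Sigma$, and $|d_\Sigma(x)|<a$ and $x=\Pi_\Sigma(x)+d_\Sigma(x)\,\nu_\Sigma(\Pi_\Sigma(x))$. (b) $d_\Sigma\in C^2(U_a)$, $\Pi_\Sigma\in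 C^1(U_a)$, and $\nabla d_\Sigma(x)=\nu_\Sigma(\Pi_\Sigma(x))$ for $x\in U_a$. (c) For $x\in U_a$, the operator $I-d_\Sigma(x)L_\Sigma(\Pi_\Sigma(x))$ is invertible and $$\nabla\Pi_\Sigma(x)=P_\Sigma(\Pi_\Sigma(x))\,M_0(d_\Sigma(x))(\Pi_\Sigma(x)).$$ In particular, $\nabla\Pi_\Sigma(p)=P_\Sigma(p)$ for $p\in\Sigma$. (d) For $x\in U_a$, the matrix $K$ at $\Pi_\Sigma(x)$ has $n-1$ real eigenvalues (counted with multiplicity), $1-d_\Sigma(x)\kappa_i(\Pi_\Sigma(x))\neq0$ for all $i$, and $$\Delta d_\Sigma(x)=-\sum_{i=1}^{n-1}\frac{\kappa_i(\Pi_\Sigma(x))}{1-d_\Sigma(x)\,\kappa_i(\Pi_\Sigma(x))}.$$ In particular, $\kappa_\Sigma(p)=-\Delta d_\Sigma(p)$ for $p\in\Sigma$. In (c) and (d) the quantities $L_\Sigma$, $\kappa_i$, $\kappa_\Sigma$ may be computed in any chart $\Phi$ as above. -/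

import Mathlib

open scoped Topology

noncomputable section

namespace Tube

/-- Euclidean space `ℝⁿ` with `n = m + 1`. -/
abbrev E (m : ℕ) : Type := EuclideanSpace ℝ (Fin (m + 1))

/-- A `C²` chart straightening the set `S` near `p`: a `C²` diffeomorphism `Φ` from an open
neighbourhood of `p` onto an open neighbourhood of `0 = Φ p` which maps the points of `S` exactly
to the points of the hyperplane `ℝ^{n-1} × {0}`. -/
structure C2Chart {m : ℕ} (S : Set (E m)) (p : E m) where
  Φ : OpenPartialHomeomorph (E m) (E m)
  mem_source : p ∈ Φ.source
  map_base : Φ p = 0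
  contDiffOn : ContDiffOn ℝ 2 Φ Φ.source
  contDiffOn_symm : ContDiffOn ℝ 2 Φ.symm Φ.target
  mem_iff : ∀ x ∈ Φ.source, x ∈ S ↔ (Φ x) (Fin.last m) = 0

/-- `S` is an embedded hypersurface of class `C²`. -/
def IsC2Hypersurface {m : ℕ} (S : Set (E m)) : Prop :=
  ∀ p ∈ S, Nonempty (C2Chart S p)

namespace C2Chart

variable {m : ℕ} {S : Set (E m)} {p : E m}

/-- The local parametrization `φ(θ) = Φ⁻¹(θ, 0)`, with `φ(0) = p`. -/
def param (c : C2Chart S p) (θ : EuclideanSpace ℝ (Fin m)) : E m :=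
  c.Φ.symm (WithLp.toLp 2 (Fin.snoc (α := fun _ => ℝ) (fun i => θ i) 0))

/-- The tangent vectors `τᵢ = ∂ᵢφ` at `p`. -/
def tau (c : C2Chart S p) (i : Fin m) : E m :=
  fderiv ℝ c.param 0 (EuclideanSpace.single i 1)

/-- The second derivatives `τᵢⱼ = ∂ᵢ∂ⱼφ` at `p`. -/
def tau2 (c : C2Chart S p) (i j : Fin m) : E m :=
  fderiv ℝ (fun θ => fderiv ℝ c.param θ (EuclideanSpace.single j 1)) 0
    (EuclideanSpace.single i 1)

/-- The first fundamental form `G = [(τᵢ|τⱼ)]`. -/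
def firstForm (c : C2Chart S p) : Matrix (Fin m) (Fin m) ℝ :=
  Matrix.of fun i j => inner ℝ (c.tau i) (c.tau j)

/-- The second fundamental form `L = [(τᵢⱼ|ν)]` with respect to the normal vector `ν` at `p`. -/
def secondForm (c : C2Chart S p) (ν : E m) : Matrix (Fin m) (Fin m) ℝ :=
  Matrix.of fun i j => inner ℝ (c.tau2 i j) ν

/-- The shape matrix `K = G⁻¹ L`. -/
def shapeMatrix (c : C2Chart S p) (ν : E m) : Matrix (Fin m) (Fin m) ℝ :=
  (c.firstForm)⁻¹ * c.secondForm ν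

/-- The principal curvatures: the (real) eigenvalues of the shape matrix, listed with their
algebraic multiplicities. -/
def principalCurvatures (c : C2Chart S p) (ν : E m) : Multiset ℝ :=
  (c.shapeMatrix ν).charpoly.roots

/-- The mean curvature `κ = tr K` (not divided by `n - 1`). -/
def meanCurvature (c : C2Chart S p) (ν : E m) : ℝ :=
  (c.shapeMatrix ν).trace

/-- The dual basis `τⁱ = gⁱᵏ τₖ` of the tangent space. -/
def dualTau (c : C2Chart S p) (i : Fin m) : E m :=
  ∑ k, (c.firstForm)⁻¹ i k • c.tau k

/-- The Weingarten tensor `∑ lᵢⱼ τⁱ ⊗ τʲ`, where `(a ⊗ b) x = (b|x) a`. -/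
def weingarten (c : C2Chart S p) (ν : E m) : E m →L[ℝ] E m :=
  ∑ i, ∑ j, c.secondForm ν i j • InnerProductSpace.rankOne ℝ (c.dualTau i) (c.dualTau j)

end C2Chart

/-- `v` is the outer unit normal at `p` of the hypersurface `S` bounding `Ω`: a unit vector,
orthogonal to the tangent space of `S` at `p`, pointing out of `Ω`. -/
structure IsOuterUnitNormal {m : ℕ} (Ω S : Set (E m)) (p v : E m) : Prop where
  norm_eq : ‖v‖ = 1
  orthogonal : ∀ (c : C2Chart S p) (i : Fin m), inner ℝ (c.tau i) v = 0
  outward : ∀ᶠ t in 𝓝[>] (0 : ℝ), p - t • v ∈ Ω ∧ p + t • v ∉ closure Ω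

/-- The outer unit normal field of the hypersurface `S` bounding `Ω`. -/
def normal {m : ℕ} (Ω S : Set (E m)) (p : E m) : E m :=
  Classical.epsilon fun v => IsOuterUnitNormal Ω S p v

/-- The uniform interior and exterior ball condition with radius `a`, for `S` separating `Ω`
from the exterior of `Ω`. -/
def UniformBallCondition {m : ℕ} (Ω S : Set (E m)) (a : ℝ) : Prop :=
  ∀ p ∈ S,
    (∃ y, Metric.ball y a ⊆ Ω ∧ S ∩ Metric.closedBall y a = {p}) ∧
    (∃ y, Metric.ball y a ⊆ (closure Ω)ᶜ ∧ S ∩ Metric.closedBall y a = {p})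

/-- The map `X(p, r) = p + r ν(p)`. -/
def tubeMap {m : ℕ} (Ω S : Set (E m)) (z : E m × ℝ) : E m :=
  z.1 + z.2 • normal Ω S z.1

/-- The tubular neighbourhood `U_a`, the image of `S × (-a, a)` under `X`. -/
def tube {m : ℕ} (Ω S : Set (E m)) (a : ℝ) : Set (E m) :=
  tubeMap Ω S '' (S ×ˢ Set.Ioo (-a) a)

/-- The signed distance to `S`, negative in `Ω`. -/
def signedDist {m : ℕ} (Ω S : Set (E m)) (x : E m) : ℝ :=
  open Classical in if x ∈ Ω then -Metric.infDist x S else Metric.infDist x S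

/-- A nearest point to `x` on `S`. -/
def proj {m : ℕ} (S : Set (E m)) (x : E m) : E m :=
  Classical.epsilon fun q => q ∈ S ∧ dist x q = Metric.infDist x S

/-- The orthogonal projection `I - ν ⊗ ν` onto the complement of a unit vector `ν`. -/
def tangentProj {m : ℕ} (ν : E m) : E m →L[ℝ] E m :=
  ContinuousLinearMap.id ℝ (E m) - InnerProductSpace.rankOne ℝ ν ν

/-- `M₀(r) = (I - r L)⁻¹` (the theorem also states that the inverse exists). -/
def M0 {m : ℕ} (L : E m →L[ℝ] E m) (r : ℝ) : E m →L[ℝ] E m :=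
  Ring.inverse (ContinuousLinearMap.id ℝ (E m) - r • L)

end Tube

end

noncomputable section

namespace Tube

open Set Filter Metric Module

variable {m : ℕ} {S Ω : Set (E m)}

/-! Near a boundary point the last chart coordinate is a `C²` function with non-zero gradient
vanishing exactly on `S`. Each of its two sides in a small chart ball is connected and misses `S`,
so it lies in `Ω` or in the exterior. If both sides lay in `Ω` at one point, connectedness of `S`
would force this everywhere; then `closure Ω` would be open and closed, hence the whole space,
against boundedness. So `Ω = {f < 0}` locally (`exists_isDefiningFunction`), and the normalized
gradient `N` is a `C¹` extension of the outer normal `ν` off `S`.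

The geometry rests on `|q - (p + rν)|² = |q - p|² - 2r (q - p|ν) + r²`. Taylor's formula and
compactness give `|(q - p|ν(p))| ≤ C |q - p|²` on `S`, which yields tangent balls of a small common
radius. Conversely, tangent balls of radius `a` give `2a |(q - p|ν(p))| < |q - p|²` for `q ≠ p`
(`abs_inner_lt`), so for `|r| < a` the point `p` is the strictly nearest boundary point to `p +
rν(p)`. Hence `X` is injective with inverse `(Π, d)`.

Applying this bound at both ends of short chords and passing to the limit gives `a |(v|N'v)| ≤ |v|²`
for tangent `v`. Therefore `I + rN'` is injective on the tangent space for `|r| < a`, and the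
inverse function theorem makes `Π` and `d` of class `C¹` on the full tube
(`contDiffAt_proj_signedDist`).

Differentiating `x = Π + d ν(Π)` (`decomposition`) gives the rest. The normal component is `∇d = ν ∘
Π`, which is `C¹`, so `d` is `C²`. Since `L = -N'` on tangent vectors, the tangential component is
`(I - dL)Π' = P`. The Hessian of `d` is then `-LΠ'`; its trace in an orthonormal eigenbasis of `L`
is the Laplacian. The eigenvalues of `L` are the principal curvatures and one extra `0` from `ν`. -/

/-- The inclusion `θ ↦ (θ, 0)` of the coordinate hyperplane. -/
def hyperplaneIncl (m : ℕ) : EuclideanSpace ℝ (Fin m) →L[ℝ] E m :=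
  LinearMap.toContinuousLinearMap
    { toFun := fun θ => WithLp.toLp 2 (Fin.snoc (α := fun _ => ℝ) (fun i => θ i) 0)
      map_add' := by
        intro x y
        ext i
        refine Fin.lastCases ?_ (fun j => ?_) i <;> simp
      map_smul' := by
        intro r x
        ext i
        refine Fin.lastCases ?_ (fun j => ?_) i <;> simp }

lemma hyperplaneIncl_last (θ : EuclideanSpace ℝ (Fin m)) :
    hyperplaneIncl m θ (Fin.last m) = 0 := by
  simp [hyperplaneIncl]

lemma hyperplaneIncl_castSucc (θ : EuclideanSpace ℝ (Fin m)) (i : Fin m) :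
    hyperplaneIncl m θ i.castSucc = θ i := by
  simp [hyperplaneIncl]

lemma hyperplaneIncl_injective : Function.Injective (hyperplaneIncl m) := by
  intro x y h
  ext i
  rw [← hyperplaneIncl_castSucc x, h, hyperplaneIncl_castSucc]

/-- The last coordinate as a linear functional. -/
def lastCoord (m : ℕ) : E m →L[ℝ] ℝ := EuclideanSpace.proj (Fin.last m)

lemma lastCoord_apply (x : E m) : lastCoord m x = x (Fin.last m) := rfl

/-- `f` is a `C²` defining function of `Ω` and of its boundary `S` in the open set `W`. -/
structure IsDefiningFunction (Ω S W : Set (E m)) (f : E m → ℝ) : Prop where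
  isOpen : IsOpen W
  contDiffOn : ContDiffOn ℝ 2 f W
  gradient_ne_zero : ∀ x ∈ W, gradient f x ≠ 0
  mem_boundary_iff : ∀ x ∈ W, x ∈ S ↔ f x = 0
  mem_iff : ∀ x ∈ W, x ∈ Ω ↔ f x < 0
  mem_closure_iff : ∀ x ∈ W, x ∈ closure Ω ↔ f x ≤ 0

lemma inner_gradient (f : E m → ℝ) (x v : E m) : inner ℝ (gradient f x) v = fderiv ℝ f x v := by
  simp [gradient]

/-! ### Charts: tangent space, normal line and height function. -/

namespace C2Chart

variable {p : E m}

lemma zero_mem_target (c : C2Chart S p) : (0 : E m) ∈ c.Φ.target := by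
  rw [← c.map_base]; exact c.Φ.map_source c.mem_source

lemma symm_zero (c : C2Chart S p) : c.Φ.symm 0 = p := by
  rw [← c.map_base, c.Φ.left_inv c.mem_source]

lemma param_eq (c : C2Chart S p) : c.param = c.Φ.symm ∘ hyperplaneIncl m := rfl

lemma param_zero (c : C2Chart S p) : c.param 0 = p := by
  rw [param_eq, Function.comp_apply, map_zero, symm_zero]

lemma contDiffAt_param (c : C2Chart S p) : ContDiffAt ℝ 2 c.param 0 := by
  rw [param_eq]
  refine ContDiffAt.comp (f := hyperplaneIncl m) 0 ?_ (hyperplaneIncl m).contDiff.contDiffAt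
  rw [map_zero]
  exact c.contDiffOn_symm.contDiffAt (c.Φ.open_target.mem_nhds c.zero_mem_target)

lemma eventually_mem_target (c : C2Chart S p) : ∀ᶠ θ in 𝓝 0, hyperplaneIncl m θ ∈ c.Φ.target := by
  refine (hyperplaneIncl m).continuous.continuousAt.eventually_mem
    (c.Φ.open_target.mem_nhds ?_)
  rw [map_zero]
  exact c.zero_mem_target

lemma eventually_param_mem (c : C2Chart S p) : ∀ᶠ θ in 𝓝 0, c.param θ ∈ S := by
  filter_upwards [c.eventually_mem_target] with θ hθ
  rw [param_eq, Function.comp_apply, c.mem_iff _ (c.Φ.map_target hθ), c.Φ.right_inv hθ,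
    hyperplaneIncl_last]

/-- The differential of the parametrization is injective. -/
lemma fderiv_param_injective (c : C2Chart S p) : Function.Injective (fderiv ℝ c.param 0) := by
  have h1 : HasFDerivAt c.param (fderiv ℝ c.param 0) 0 :=
    (c.contDiffAt_param.differentiableAt (by norm_num)).hasFDerivAt
  have h2 : HasFDerivAt c.Φ (fderiv ℝ c.Φ p) (c.param 0) := by
    rw [param_zero]
    exact ((c.contDiffOn.contDiffAt (c.Φ.open_source.mem_nhds c.mem_source)).differentiableAt
      (by norm_num)).hasFDerivAt
  have h3 := h2.comp _ h1
  -- The chart undoes the parametrization, so the differential of `Φ` at `p` is a left inverse of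
  -- `φ'(0)` up to the injective inclusion.
  have h4 : HasFDerivAt (c.Φ ∘ c.param) (hyperplaneIncl m) 0 := by
    refine (hyperplaneIncl m).hasFDerivAt.congr_of_eventuallyEq ?_
    filter_upwards [c.eventually_mem_target] with θ hθ
    exact c.Φ.right_inv hθ
  have h5 := h3.unique h4
  intro x y hxy
  apply hyperplaneIncl_injective
  rw [← h5]
  simp [hxy]

lemma fderiv_param_apply (c : C2Chart S p) (θ : EuclideanSpace ℝ (Fin m)) :
    fderiv ℝ c.param 0 θ = ∑ i, θ i • c.tau i := by
  have h := (EuclideanSpace.basisFun (Fin m) ℝ).sum_repr θ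
  conv_lhs => rw [← h]
  simp [tau]

lemma linearIndependent_tau (c : C2Chart S p) : LinearIndependent ℝ c.tau := by
  have h : c.tau = fderiv ℝ c.param 0 ∘ (EuclideanSpace.basisFun (Fin m) ℝ).toBasis := by
    ext i : 1
    simp [tau]
  rw [h]
  exact (EuclideanSpace.basisFun (Fin m) ℝ).toBasis.linearIndependent.map'
    (fderiv ℝ c.param 0).toLinearMap (LinearMap.ker_eq_bot.2 c.fderiv_param_injective)

/-- The orthogonal complement of the tangent space is spanned by any unit normal vector. -/
lemma exists_smul_of_orthogonal (c : C2Chart S p) {v w : E m} (hv : ‖v‖ = 1)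
    (hvt : ∀ i, inner ℝ (c.tau i) v = 0) (hwt : ∀ i, inner ℝ (c.tau i) w = 0) :
    ∃ r : ℝ, w = r • v := by
  set T := Submodule.span ℝ (range c.tau)
  have hT : finrank ℝ T = m := by
    simpa using finrank_span_eq_card c.linearIndependent_tau
  have hT' : finrank ℝ Tᗮ = 1 := by
    have := T.finrank_add_finrank_orthogonal
    simp at this
    omega
  have key : ∀ u : E m, (∀ i, inner ℝ (c.tau i) u = 0) → u ∈ Tᗮ := by
    intro u hu
    rw [Submodule.mem_orthogonal]
    intro t ht
    induction ht using Submodule.span_induction with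
    | mem x hx => obtain ⟨i, rfl⟩ := hx; exact hu i
    | zero => simp
    | add x y _ _ hx hy => rw [inner_add_left, hx, hy, add_zero]
    | smul r x _ hx => rw [inner_smul_left, hx, mul_zero]
  have hv0 : (⟨v, key v hvt⟩ : Tᗮ) ≠ 0 := by
    intro h
    have : v = 0 := congrArg Subtype.val h
    simp [this] at hv
  obtain ⟨r, hr⟩ := (finrank_eq_one_iff_of_nonzero' _ hv0).1 hT' ⟨w, key w hwt⟩
  exact ⟨r, (congrArg Subtype.val hr).symm⟩

/-- A vector orthogonal to the normal is tangent. -/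
lemma exists_fderiv_param_eq (c : C2Chart S p) {v w : E m} (hv : ‖v‖ = 1)
    (hvt : ∀ i, inner ℝ (c.tau i) v = 0) (hw : inner ℝ v w = 0) :
    ∃ θ, fderiv ℝ c.param 0 θ = w := by
  set T := Submodule.span ℝ (range c.tau)
  have hwT : w ∈ T := by
    -- `T = Tᗮᗮ`, and `Tᗮ` is the line through `v`, so orthogonality to `v` suffices.
    rw [← T.orthogonal_orthogonal, Submodule.mem_orthogonal]
    intro u hu
    have hu' : ∀ i, inner ℝ (c.tau i) u = 0 := fun i =>
      (Submodule.mem_orthogonal T u).1 hu _ (Submodule.subset_span (mem_range_self i))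
    obtain ⟨r, rfl⟩ := c.exists_smul_of_orthogonal hv hvt hu'
    rw [inner_smul_left, hw, mul_zero]
  have hle : T ≤ LinearMap.range (fderiv ℝ c.param 0).toLinearMap := by
    rw [Submodule.span_le]
    rintro _ ⟨i, rfl⟩
    exact ⟨_, rfl⟩
  exact hle hwT

/-- The last coordinate of a chart. -/
def height (c : C2Chart S p) (x : E m) : ℝ := c.Φ x (Fin.last m)

lemma contDiffOn_height (c : C2Chart S p) : ContDiffOn ℝ 2 c.height c.Φ.source :=
  (lastCoord m).contDiff.comp_contDiffOn c.contDiffOn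

/-- Composed with `Φ⁻¹`, the height is the last coordinate, whose derivative does not vanish. -/
lemma gradient_height_ne_zero (c : C2Chart S p) {x : E m} (hx : x ∈ c.Φ.source) :
    gradient c.height x ≠ 0 := by
  intro h0
  have hd : HasFDerivAt c.height (fderiv ℝ c.height x) (c.Φ.symm (c.Φ x)) := by
    rw [c.Φ.left_inv hx]
    exact ((c.contDiffOn_height.contDiffAt (c.Φ.open_source.mem_nhds hx)).differentiableAt
      (by norm_num)).hasFDerivAt
  have hs : HasFDerivAt c.Φ.symm (fderiv ℝ c.Φ.symm (c.Φ x)) (c.Φ x) :=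
    ((c.contDiffOn_symm.contDiffAt (c.Φ.open_target.mem_nhds (c.Φ.map_source hx))).differentiableAt
      (by norm_num)).hasFDerivAt
  have h1 := hd.comp _ hs
  have h2 : HasFDerivAt (c.height ∘ c.Φ.symm) (lastCoord m) (c.Φ x) := by
    refine (ContinuousLinearMap.hasFDerivAt _).congr_of_eventuallyEq ?_
    filter_upwards [c.Φ.open_target.mem_nhds (c.Φ.map_source hx)] with z hz
    simp [height, lastCoord_apply, c.Φ.right_inv hz]
  have h3 := congrArg (fun A : E m →L[ℝ] ℝ => A (EuclideanSpace.single (Fin.last m) 1))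
    (h1.unique h2)
  simp [← inner_gradient, h0, lastCoord_apply] at h3

end C2Chart

/-! ### Local defining functions: the domain lies on one side of its boundary. -/

/-- A function with non-vanishing gradient changes sign along the gradient direction. -/
lemma eventually_sign_along {f : E m → ℝ} {x v : E m} (hf : DifferentiableAt ℝ f x)
    (h0 : f x = 0) (hv : 0 < fderiv ℝ f x v) :
    ∀ᶠ t in 𝓝[>] (0 : ℝ), f (x - t • v) < 0 ∧ 0 < f (x + t • v) := by
  -- Dividing by `t` treats both signs of `t` at once: `f` has the sign of `t` along the line.
  have key : ∀ u : E m, 0 < fderiv ℝ f x u → ∀ᶠ t in 𝓝 (0 : ℝ), t ≠ 0 → 0 < t⁻¹ * f (x + t • u) := by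
    intro u hu
    have h1 : HasDerivAt (fun t : ℝ => f (x + t • u)) (fderiv ℝ f x u) 0 := by
      have h2 : HasDerivAt (fun t : ℝ => x + t • u) u 0 := by
        simpa using ((hasDerivAt_id (0 : ℝ)).smul_const u).const_add x
      have h3 : HasFDerivAt f (fderiv ℝ f x) (x + (0 : ℝ) • u) := by simpa using hf.hasFDerivAt
      exact h3.comp_hasDerivAt _ h2
    have h4 := h1.tendsto_slope.eventually (lt_mem_nhds hu)
    rw [eventually_nhdsWithin_iff] at h4
    filter_upwards [h4] with t ht ht0
    simpa [slope_def_field, h0, div_eq_inv_mul] using ht ht0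
  have hv1 := key v hv
  have hneg : Tendsto (fun t : ℝ => -t) (𝓝 0) (𝓝 0) := by
    simpa using (continuous_neg (G := ℝ)).tendsto 0
  have hv2 := hneg.eventually hv1
  filter_upwards [self_mem_nhdsWithin, nhdsWithin_le_nhds hv1, nhdsWithin_le_nhds hv2]
    with t ht h1 h2
  have ht' : (0 : ℝ) < t := ht
  have h1' := h1 ht'.ne'
  have h2' := h2 (by linarith)
  refine ⟨?_, ?_⟩
  · rw [neg_smul, ← sub_eq_add_neg] at h2'
    by_contra hc
    have : (-t)⁻¹ ≤ 0 := inv_nonpos.2 (by linarith)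
    nlinarith
  · exact (pos_iff_pos_of_mul_pos h1').1 (inv_pos.2 ht')

lemma IsDefiningFunction.contDiffAt {W : Set (E m)} {f : E m → ℝ}
    (hf : IsDefiningFunction Ω S W f) {x : E m} (hx : x ∈ W) : ContDiffAt ℝ 2 f x :=
  hf.contDiffOn.contDiffAt (hf.isOpen.mem_nhds hx)

lemma IsDefiningFunction.differentiableAt {W : Set (E m)} {f : E m → ℝ}
    (hf : IsDefiningFunction Ω S W f) {x : E m} (hx : x ∈ W) : DifferentiableAt ℝ f x :=
  (hf.contDiffAt hx).differentiableAt (by norm_num)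

/-- Near a boundary point a domain bounded by a hypersurface either lies on exactly one side,
where it has a defining function, or on both sides. -/
lemma exists_isDefiningFunction_or (hΩ_open : IsOpen Ω) (hΩS : frontier Ω = S) {p : E m}
    (hp : p ∈ S) (c : C2Chart S p) :
    (∃ W f, p ∈ W ∧ IsDefiningFunction Ω S W f) ∨ p ∈ interior (closure Ω) := by
  obtain ⟨ε, hε, hball⟩ := Metric.isOpen_iff.1 c.Φ.open_target 0 c.zero_mem_target
  set W : Set (E m) := c.Φ.source ∩ c.Φ ⁻¹' ball 0 ε with hW
  have hWo : IsOpen W := c.Φ.isOpen_inter_preimage isOpen_ball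
  have hpW : p ∈ W := ⟨c.mem_source, by simp [c.map_base, hε]⟩
  have hSW : ∀ x ∈ W, x ∈ S ↔ c.height x = 0 := fun x hx => c.mem_iff x hx.1
  have hdisj : Disjoint Ω (closure Ω)ᶜ :=
    disjoint_left.2 fun x hx hx' => hx' (subset_closure hx)
  have hcl : ∀ x, x ∈ closure Ω ↔ x ∈ Ω ∨ x ∈ S := by
    intro x
    rw [← hΩS, hΩ_open.frontier_eq]
    constructor
    · intro h
      by_cases hx : x ∈ Ω
      · exact Or.inl hx
      · exact Or.inr ⟨h, hx⟩
    · rintro (h | h)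
      · exact subset_closure h
      · exact h.1
  have hΩnS : ∀ x ∈ S, x ∉ Ω := by
    intro x hx
    rw [← hΩS, hΩ_open.frontier_eq] at hx
    exact hx.2
  have hlin : IsLinearMap ℝ fun z : E m => z (Fin.last m) :=
    (lastCoord m).toLinearMap.isLinear
  -- A half of the chart ball is convex, so its image is connected; it avoids the frontier and
  -- cannot meet both `Ω` and the exterior.
  have side : ∀ H : Set ℝ, Convex ℝ ((fun z : E m => z (Fin.last m)) ⁻¹' H) → (0 : ℝ) ∉ H →
      (W ∩ c.height ⁻¹' H ⊆ Ω) ∨ (W ∩ c.height ⁻¹' H ⊆ (closure Ω)ᶜ) := by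
    intro H hH h0
    have himg : W ∩ c.height ⁻¹' H =
        c.Φ.symm '' (ball 0 ε ∩ (fun z : E m => z (Fin.last m)) ⁻¹' H) := by
      ext x
      constructor
      · rintro ⟨hx, hx'⟩
        exact ⟨c.Φ x, ⟨hx.2, hx'⟩, c.Φ.left_inv hx.1⟩
      · rintro ⟨z, ⟨hz, hz'⟩, rfl⟩
        have ht := hball hz
        refine ⟨⟨c.Φ.map_target ht, ?_⟩, ?_⟩
        · rw [mem_preimage, c.Φ.right_inv ht]; exact hz
        · rw [mem_preimage, C2Chart.height, c.Φ.right_inv ht]; exact hz'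
    have hpre : IsPreconnected (W ∩ c.height ⁻¹' H) := by
      rw [himg]
      exact (((convex_ball 0 ε).inter hH).isPreconnected).image _
        (c.Φ.continuousOn_symm.mono (inter_subset_left.trans hball))
    refine IsPreconnected.subset_or_subset hΩ_open isClosed_closure.isOpen_compl hdisj ?_ hpre
    rintro x ⟨hx, hx'⟩
    by_cases h : x ∈ Ω
    · exact Or.inl h
    · refine Or.inr fun hxc => ?_
      rcases (hcl x).1 hxc with h' | h'
      · exact h h'
      · rw [mem_preimage, (hSW x hx).1 h'] at hx'
        exact h0 hx'
  have hpos := side (Ioi 0) (convex_halfSpace_gt hlin 0) (by simp)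
  have hneg := side (Iio 0) (convex_halfSpace_lt hlin 0) (by simp)
  have hgrad : ∀ x ∈ W, gradient c.height x ≠ 0 := fun x hx => c.gradient_height_ne_zero hx.1
  have hC : ContDiffOn ℝ 2 c.height W := c.contDiffOn_height.mono inter_subset_left
  rcases hneg with hneg | hneg <;> rcases hpos with hpos | hpos
  · right
    refine mem_interior.2 ⟨W, fun x hx => ?_, hWo, hpW⟩
    rcases lt_trichotomy (c.height x) 0 with h | h | h
    · exact subset_closure (hneg ⟨hx, h⟩)
    · exact (hcl x).2 (Or.inr ((hSW x hx).2 h))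
    · exact subset_closure (hpos ⟨hx, h⟩)
  · left
    have hmem : ∀ x ∈ W, x ∈ Ω ↔ c.height x < 0 := by
      intro x hx
      refine ⟨fun h => ?_, fun h => hneg ⟨hx, h⟩⟩
      by_contra! h'
      rcases h'.eq_or_lt with h' | h'
      · exact hΩnS x ((hSW x hx).2 h'.symm) h
      · exact hpos ⟨hx, h'⟩ (subset_closure h)
    refine ⟨W, c.height, hpW, hWo, hC, hgrad, hSW, hmem, fun x hx => ?_⟩
    rw [hcl, hmem x hx, hSW x hx, le_iff_lt_or_eq]
  · left
    have hmem : ∀ x ∈ W, x ∈ Ω ↔ -c.height x < 0 := by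
      intro x hx
      refine ⟨fun h => ?_, fun h => hpos ⟨hx, by simpa using h⟩⟩
      by_contra! h'
      have h' : c.height x ≤ 0 := by linarith
      rcases h'.eq_or_lt with h' | h'
      · exact hΩnS x ((hSW x hx).2 h') h
      · exact hneg ⟨hx, h'⟩ (subset_closure h)
    refine ⟨W, fun x => -c.height x, hpW, hWo, hC.neg, fun x hx => ?_, fun x hx => ?_, hmem,
      fun x hx => ?_⟩
    · have h := hgrad x hx
      have : gradient (fun x => -c.height x) x = -gradient c.height x := by
        simp [gradient, fderiv_fun_neg]
      rw [this]
      exact neg_ne_zero.2 h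
    · rw [hSW x hx, neg_eq_zero]
    · rw [hcl, hmem x hx, hSW x hx, le_iff_lt_or_eq, neg_eq_zero]
  -- With the exterior on both sides, `p` could not be a limit of points of `Ω`.
  · exfalso
    have hpc : p ∈ closure Ω := (hcl p).2 (Or.inr hp)
    obtain ⟨x, hxW, hxΩ⟩ := mem_closure_iff.1 hpc W hWo hpW
    rcases lt_trichotomy (c.height x) 0 with h | h | h
    · exact hneg ⟨hxW, h⟩ (subset_closure hxΩ)
    · exact hΩnS x ((hSW x hxW).2 h) hxΩ
    · exact hpos ⟨hxW, h⟩ (subset_closure hxΩ)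

/-- A bounded domain with connected `C²` boundary has local defining functions. -/
lemma exists_isDefiningFunction (hS_conn : IsConnected S) (hS : IsC2Hypersurface S)
    (hΩ_open : IsOpen Ω) (hΩ_conn : IsConnected Ω) (hΩ_bdd : Bornology.IsBounded Ω)
    (hΩS : frontier Ω = S) {p : E m} (hp : p ∈ S) :
    ∃ W f, p ∈ W ∧ IsDefiningFunction Ω S W f := by
  set U : Set (E m) := {x | ∃ W f, x ∈ W ∧ IsDefiningFunction Ω S W f} with hU
  have hUo : IsOpen U := by
    refine isOpen_iff_mem_nhds.2 ?_
    rintro x ⟨W, f, hx, hf⟩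
    filter_upwards [hf.isOpen.mem_nhds hx] with y hy
    exact ⟨W, f, hy, hf⟩
  have hcover : S ⊆ U ∪ interior (closure Ω) := fun x hx =>
    exists_isDefiningFunction_or hΩ_open hΩS hx (hS x hx).some
  -- Moving from a one-sided point along the gradient makes `f` positive, so exterior points lie
  -- arbitrarily near.
  have hempty : ¬ (S ∩ (U ∩ interior (closure Ω))).Nonempty := by
    rintro ⟨x, hxS, ⟨W, f, hxW, hf⟩, hxi⟩
    have hg := hf.gradient_ne_zero x hxW
    have hpos : 0 < fderiv ℝ f x (gradient f x) := by
      rw [← inner_gradient]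
      exact real_inner_self_pos.2 hg
    have h1 := eventually_sign_along (hf.differentiableAt hxW)
      ((hf.mem_boundary_iff x hxW).1 hxS) hpos
    have hlim : Tendsto (fun t : ℝ => x + t • gradient f x) (𝓝[>] 0) (𝓝 x) := by
      have : Continuous fun t : ℝ => x + t • gradient f x := by fun_prop
      simpa using (this.tendsto 0).mono_left nhdsWithin_le_nhds
    have h2 := hlim.eventually (isOpen_interior.mem_nhds hxi)
    have h3 := hlim.eventually (hf.isOpen.mem_nhds hxW)
    obtain ⟨t, ⟨-, ht1⟩, ht2, ht3⟩ := (h1.and (h2.and h3)).exists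
    exact absurd ((hf.mem_closure_iff _ ht3).1 (interior_subset ht2)) (not_le.2 ht1)
  have hne : ¬ (S ∩ interior (closure Ω)).Nonempty := by
    intro hne
    have hSi : S ⊆ interior (closure Ω) := by
      intro x hx
      rcases hcover hx with h | h
      · exact absurd (hS_conn.isPreconnected U _ hUo isOpen_interior hcover ⟨x, hx, h⟩ hne) hempty
      · exact h
    -- If all of `S` is interior to `closure Ω`, then `closure Ω` is open as well as closed.
    have hclopen : IsClopen (closure Ω) := by
      refine ⟨isClosed_closure, ?_⟩
      rw [← interior_eq_iff_isOpen]
      refine interior_subset.antisymm fun x hx => ?_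
      by_cases hxΩ : x ∈ Ω
      · exact interior_mono subset_closure (by rwa [hΩ_open.interior_eq])
      · refine hSi ?_
        rw [← hΩS, hΩ_open.frontier_eq]
        exact ⟨hx, hxΩ⟩
    have huniv : closure Ω = univ := hclopen.eq_univ hΩ_conn.nonempty.closure
    have hb := hΩ_bdd.closure
    rw [huniv] at hb
    exact NormedSpace.unbounded_univ ℝ (E m) hb
  rcases hcover hp with h | h
  · exact h
  · exact absurd ⟨p, hp, h⟩ hne

/-! ### The outer unit normal as a normalized gradient. -/

/-- The normalized gradient. -/
def unitGradient (f : E m → ℝ) (x : E m) : E m := ‖gradient f x‖⁻¹ • gradient f x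

/-- A bounded domain with compact `C²` boundary lying locally on one side of its boundary. -/
structure IsRegularDomain (Ω S : Set (E m)) : Prop where
  isCompact : IsCompact S
  nonempty : S.Nonempty
  isC2Hypersurface : IsC2Hypersurface S
  isOpen : IsOpen Ω
  frontier_eq : frontier Ω = S
  exists_definingFunction : ∀ p ∈ S, ∃ W f, p ∈ W ∧ IsDefiningFunction Ω S W f

namespace IsDefiningFunction

variable {W : Set (E m)} {f : E m → ℝ}

lemma norm_unitGradient (hf : IsDefiningFunction Ω S W f) {x : E m} (hx : x ∈ W) :
    ‖unitGradient f x‖ = 1 := by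
  have h := norm_ne_zero_iff.2 (hf.gradient_ne_zero x hx)
  rw [unitGradient, norm_smul, norm_inv, norm_norm, inv_mul_cancel₀ h]

lemma contDiffOn_gradient (hf : IsDefiningFunction Ω S W f) : ContDiffOn ℝ 1 (gradient f) W :=
  (InnerProductSpace.toDual ℝ (E m)).symm.toContinuousLinearEquiv.contDiff.comp_contDiffOn
    (hf.contDiffOn.fderiv_of_isOpen hf.isOpen (by norm_num))

lemma contDiffOn_unitGradient (hf : IsDefiningFunction Ω S W f) :
    ContDiffOn ℝ 1 (unitGradient f) W := by
  have hg := hf.contDiffOn_gradient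
  exact ((hg.norm ℝ hf.gradient_ne_zero).inv fun x hx =>
    norm_ne_zero_iff.2 (hf.gradient_ne_zero x hx)).smul hg

/-- Maps into the boundary have derivatives orthogonal to the gradient. -/
lemma inner_unitGradient_eq_zero (hf : IsDefiningFunction Ω S W f) {F : Type*}
    [NormedAddCommGroup F] [NormedSpace ℝ F] {g : F → E m} {g' : F →L[ℝ] E m} {y : F}
    (hg : HasFDerivAt g g' y) (hgS : ∀ᶠ z in 𝓝 y, g z ∈ S) (hy : g y ∈ W) (h : F) :
    inner ℝ (unitGradient f (g y)) (g' h) = 0 := by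
  have h1 := (hf.differentiableAt hy).hasFDerivAt.comp y hg
  have h2 : HasFDerivAt (f ∘ g) (0 : F →L[ℝ] ℝ) y := by
    refine (hasFDerivAt_const (0 : ℝ) y).congr_of_eventuallyEq ?_
    filter_upwards [hgS, hg.continuousAt.eventually_mem (hf.isOpen.mem_nhds hy)] with z hz hz'
    exact (hf.mem_boundary_iff _ hz').1 hz
  have h3 := congrArg (fun A : F →L[ℝ] ℝ => A h) (h1.unique h2)
  simp only [ContinuousLinearMap.comp_apply, zero_apply] at h3
  rw [unitGradient, inner_smul_left, inner_gradient, h3, mul_zero]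

lemma isOuterUnitNormal (hf : IsDefiningFunction Ω S W f) {x : E m} (hx : x ∈ W) (hxS : x ∈ S) :
    IsOuterUnitNormal Ω S x (unitGradient f x) where
  norm_eq := hf.norm_unitGradient hx
  orthogonal := by
    intro c i
    have h := hf.inner_unitGradient_eq_zero
      (c.contDiffAt_param.differentiableAt (by norm_num)).hasFDerivAt c.eventually_param_mem
      (by rwa [c.param_zero]) (EuclideanSpace.single i 1)
    rwa [c.param_zero, real_inner_comm] at h
  outward := by
    have hg := hf.gradient_ne_zero x hx
    have hpos : 0 < fderiv ℝ f x (unitGradient f x) := by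
      rw [← inner_gradient, unitGradient, inner_smul_right]
      exact mul_pos (inv_pos.2 (norm_pos_iff.2 hg)) (real_inner_self_pos.2 hg)
    have hlim : ∀ v : E m, Tendsto (fun t : ℝ => x + t • v) (𝓝[>] 0) (𝓝 x) := by
      intro v
      have : Continuous fun t : ℝ => x + t • v := by fun_prop
      simpa using (this.tendsto 0).mono_left nhdsWithin_le_nhds
    filter_upwards [eventually_sign_along (hf.differentiableAt hx)
      ((hf.mem_boundary_iff x hx).1 hxS) hpos,
      (hlim (unitGradient f x)).eventually (hf.isOpen.mem_nhds hx),
      (hlim (-unitGradient f x)).eventually (hf.isOpen.mem_nhds hx)] with t ht h1 h2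
    rw [smul_neg, ← sub_eq_add_neg] at h2
    exact ⟨(hf.mem_iff _ h2).2 ht.1, fun h => not_le.2 ht.2 ((hf.mem_closure_iff _ h1).1 h)⟩

end IsDefiningFunction

/-- The normal space is a line, so `v = ±w`; with the minus sign `p + t w` would be both in `Ω` and
outside its closure for small `t > 0`. -/
lemma IsOuterUnitNormal.unique {p v w : E m} (c : C2Chart S p) (hv : IsOuterUnitNormal Ω S p v)
    (hw : IsOuterUnitNormal Ω S p w) : v = w := by
  obtain ⟨r, hr⟩ := c.exists_smul_of_orthogonal hw.norm_eq (hw.orthogonal c) (hv.orthogonal c)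
  have hr1 : |r| = 1 := by
    have := hv.norm_eq
    rwa [hr, norm_smul, hw.norm_eq, mul_one, Real.norm_eq_abs] at this
  rcases (abs_eq zero_le_one).1 hr1 with h | h
  · rw [hr, h, one_smul]
  · exfalso
    obtain ⟨t, ht1, ht2⟩ := (hv.outward.and hw.outward).exists
    rw [hr, h, neg_one_smul, smul_neg, sub_neg_eq_add] at ht1
    exact ht2.2 (subset_closure ht1.1)

/-! ### Quadratic tangency and existence of the uniform ball condition. -/

namespace IsRegularDomain

lemma isOuterUnitNormal_normal (hR : IsRegularDomain Ω S) {p : E m} (hp : p ∈ S) :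
    IsOuterUnitNormal Ω S p (normal Ω S p) := by
  obtain ⟨W, f, hpW, hf⟩ := hR.exists_definingFunction p hp
  exact Classical.epsilon_spec (p := fun v => IsOuterUnitNormal Ω S p v)
    ⟨_, hf.isOuterUnitNormal hpW hp⟩

lemma norm_normal (hR : IsRegularDomain Ω S) {p : E m} (hp : p ∈ S) : ‖normal Ω S p‖ = 1 :=
  (hR.isOuterUnitNormal_normal hp).norm_eq

lemma normal_eq_unitGradient (hR : IsRegularDomain Ω S) {W : Set (E m)} {f : E m → ℝ}
    (hf : IsDefiningFunction Ω S W f) {p : E m} (hp : p ∈ S) (hpW : p ∈ W) :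
    normal Ω S p = unitGradient f p :=
  (hR.isOuterUnitNormal_normal hp).unique (hR.isC2Hypersurface p hp).some
    (hf.isOuterUnitNormal hpW hp)

lemma notMem_of_mem_boundary (hR : IsRegularDomain Ω S) {x : E m} (hx : x ∈ S) : x ∉ Ω := by
  rw [← hR.frontier_eq, hR.isOpen.frontier_eq] at hx
  exact hx.2

lemma mem_closure_of_mem_boundary (hR : IsRegularDomain Ω S) {x : E m} (hx : x ∈ S) :
    x ∈ closure Ω := by
  rw [← hR.frontier_eq, hR.isOpen.frontier_eq] at hx
  exact hx.1

/-- Since `f` vanishes at `p` and `q`, Taylor's formula with Lipschitz `f'` gives `|f'(p)(q - p)| ≤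
K |q - p|²`; dividing by `|∇f(p)|`, bounded below by `b`, turns this into a bound for the normal. -/
lemma exists_quadratic_bound_near (hR : IsRegularDomain Ω S) {p₀ : E m} (hp₀ : p₀ ∈ S) :
    ∃ C : ℝ, ∃ U ∈ 𝓝 p₀, ∀ p ∈ S ∩ U, ∀ q ∈ S ∩ U,
      |inner ℝ (q - p) (normal Ω S p)| ≤ C * ‖q - p‖ ^ 2 := by
  obtain ⟨W, f, hpW, hf⟩ := hR.exists_definingFunction p₀ hp₀
  have hW := hf.isOpen.mem_nhds hpW
  obtain ⟨K, t, ht, hK⟩ := ((hf.contDiffOn.fderiv_of_isOpen hf.isOpen (m := 1)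
    (by norm_num)).contDiffAt hW).exists_lipschitzOnWith
  set b := ‖gradient f p₀‖ / 2
  have hb : 0 < b := half_pos (norm_pos_iff.2 (hf.gradient_ne_zero _ hpW))
  have hgr : ∀ᶠ x in 𝓝 p₀, b < ‖gradient f x‖ :=
    (hf.contDiffOn_gradient.continuousOn.continuousAt hW).norm.eventually
      (lt_mem_nhds (half_lt_self (norm_pos_iff.2 (hf.gradient_ne_zero _ hpW))))
  obtain ⟨ε, hε, hball⟩ := Metric.mem_nhds_iff.1 (inter_mem (inter_mem hW ht) hgr)
  refine ⟨b⁻¹ * K, ball p₀ ε, ball_mem_nhds _ hε, ?_⟩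
  rintro p ⟨hpS, hp⟩ q ⟨hqS, hq⟩
  obtain ⟨⟨hpW', hpt⟩, hpb⟩ := hball hp
  have hqW := (hball hq).1.1
  have hT : ‖f q - f p - fderiv ℝ f p (q - p)‖ ≤ K * ‖q - p‖ * ‖q - p‖ := by
    refine Convex.norm_image_sub_le_of_norm_fderiv_le' (𝕜 := ℝ)
      -- Cutting with the closed ball around `p` bounds the variation of `f'` by `K ‖q - p‖`, which
      -- makes the estimate quadratic.
      (s := ball p₀ ε ∩ closedBall p ‖q - p‖) (fun x hx => hf.differentiableAt (hball hx.1).1.1)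
      (fun x hx => ?_) ((convex_ball _ _).inter (convex_closedBall _ _)) ⟨hp, by simp⟩
      ⟨hq, by simp [dist_eq_norm]⟩
    calc ‖fderiv ℝ f x - fderiv ℝ f p‖ ≤ K * ‖x - p‖ := by
          simpa [dist_eq_norm] using hK.dist_le_mul x (hball hx.1).1.2 p hpt
      _ ≤ K * ‖q - p‖ := by
          gcongr
          simpa [dist_eq_norm] using hx.2
  rw [(hf.mem_boundary_iff _ hqW).1 hqS, (hf.mem_boundary_iff _ hpW').1 hpS, sub_zero, zero_sub,
    norm_neg, ← inner_gradient, Real.norm_eq_abs] at hT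
  rw [hR.normal_eq_unitGradient hf hpS hpW', unitGradient, inner_smul_right, real_inner_comm,
    abs_mul, abs_inv, abs_norm, mul_assoc]
  have hpb' : b < ‖gradient f p‖ := hpb
  calc ‖gradient f p‖⁻¹ * |inner ℝ (gradient f p) (q - p)|
      ≤ b⁻¹ * (K * ‖q - p‖ * ‖q - p‖) := by gcongr
    _ = b⁻¹ * (K * ‖q - p‖ ^ 2) := by ring

/-- The boundary is quadratically close to its tangent planes. -/
lemma exists_quadratic_bound (hR : IsRegularDomain Ω S) :
    ∃ C : ℝ, ∀ p ∈ S, ∀ q ∈ S, |inner ℝ (q - p) (normal Ω S p)| ≤ C * ‖q - p‖ ^ 2 := by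
  suffices h : ∃ C : ℝ, ∀ z ∈ S ×ˢ S, z ∈ S ×ˢ S →
      |inner ℝ (z.2 - z.1) (normal Ω S z.1)| ≤ C * ‖z.2 - z.1‖ ^ 2 by
    obtain ⟨C, hC⟩ := h
    exact ⟨C, fun p hp q hq => hC (p, q) ⟨hp, hq⟩ ⟨hp, hq⟩⟩
  refine IsCompact.induction_on (hR.isCompact.prod hR.isCompact)
    (p := fun T => ∃ C : ℝ, ∀ z ∈ T, z ∈ S ×ˢ S →
      |inner ℝ (z.2 - z.1) (normal Ω S z.1)| ≤ C * ‖z.2 - z.1‖ ^ 2) ?_ ?_ ?_ ?_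
  · exact ⟨0, by simp⟩
  · rintro s t hst ⟨C, hC⟩
    exact ⟨C, fun z hz => hC z (hst hz)⟩
  · rintro s t ⟨C, hC⟩ ⟨D, hD⟩
    refine ⟨max C D, ?_⟩
    rintro z (hz | hz) hzS
    · exact (hC z hz hzS).trans (by gcongr; exact le_max_left _ _)
    · exact (hD z hz hzS).trans (by gcongr; exact le_max_right _ _)
  · rintro ⟨p, q⟩ ⟨hp, hq⟩
    simp only at hp hq
    by_cases hpq : p = q
    · subst hpq
      obtain ⟨C, U, hU, hC⟩ := hR.exists_quadratic_bound_near hp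
      exact ⟨U ×ˢ U, mem_nhdsWithin_of_mem_nhds (prod_mem_nhds hU hU), C, fun z hz hzS =>
        hC z.1 ⟨hzS.1, hz.1⟩ z.2 ⟨hzS.2, hz.2⟩⟩
    -- Off the diagonal `‖q - p‖` stays above `δ`, so Cauchy–Schwarz is already quadratic with
    -- constant `δ⁻¹`.
    · set δ := ‖q - p‖ / 2
      have hδ : 0 < δ := half_pos (norm_pos_iff.2 (sub_ne_zero.2 (Ne.symm hpq)))
      have hev : ∀ᶠ z : E m × E m in 𝓝 (p, q), δ < ‖z.2 - z.1‖ := by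
        have : Continuous fun z : E m × E m => ‖z.2 - z.1‖ := by fun_prop
        exact this.continuousAt.eventually (lt_mem_nhds
          (half_lt_self (norm_pos_iff.2 (sub_ne_zero.2 (Ne.symm hpq)))))
      refine ⟨_, mem_nhdsWithin_of_mem_nhds hev, δ⁻¹, fun z hz hzS => ?_⟩
      have hz' : δ < ‖z.2 - z.1‖ := hz
      calc |inner ℝ (z.2 - z.1) (normal Ω S z.1)| ≤ ‖z.2 - z.1‖ * ‖normal Ω S z.1‖ :=
            abs_real_inner_le_norm _ _
        _ = δ⁻¹ * (δ * ‖z.2 - z.1‖) := by rw [hR.norm_normal hzS.1]; field_simp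
        _ ≤ δ⁻¹ * ‖z.2 - z.1‖ ^ 2 := by rw [sq]; gcongr

lemma norm_sub_smul_normal_sq (hR : IsRegularDomain Ω S) {p : E m} (hp : p ∈ S) (q : E m) (r : ℝ) :
    ‖q - (p + r • normal Ω S p)‖ ^ 2 =
      ‖q - p‖ ^ 2 - 2 * r * inner ℝ (q - p) (normal Ω S p) + r ^ 2 := by
  rw [← sub_sub, norm_sub_sq_real, inner_smul_right, norm_smul, hR.norm_normal hp, mul_one,
    Real.norm_eq_abs, sq_abs]
  ring

/-- A preconnected set disjoint from the boundary lies inside or outside the domain. -/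
lemma subset_of_isPreconnected (hR : IsRegularDomain Ω S) {A : Set (E m)} (hA : IsPreconnected A)
    (hAS : Disjoint A S) : A ⊆ Ω ∨ A ⊆ (closure Ω)ᶜ := by
  refine IsPreconnected.subset_or_subset hR.isOpen isClosed_closure.isOpen_compl
    (disjoint_left.2 fun x hx hx' => hx' (subset_closure hx)) (fun x hx => ?_) hA
  by_cases h : x ∈ Ω
  · exact Or.inl h
  · refine Or.inr fun hc => disjoint_left.1 hAS hx ?_
    rw [← hR.frontier_eq, hR.isOpen.frontier_eq]
    exact ⟨hc, h⟩

lemma eventually_mem_ball_smul {a : ℝ} (ha : 0 < a) (p v : E m) (hv : ‖v‖ = 1) :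
    ∀ᶠ t in 𝓝[>] (0 : ℝ), p + t • v ∈ ball (p + a • v) a := by
  filter_upwards [Ioo_mem_nhdsGT ha] with t ht
  rw [mem_ball, dist_eq_norm, add_sub_add_left_eq_sub, ← sub_smul, norm_smul, hv, mul_one,
    Real.norm_eq_abs, abs_lt]
  constructor <;> linarith [ht.1, ht.2]

/-- Bounded domains of class `C²` satisfy a uniform ball condition. -/
lemma exists_uniformBallCondition (hR : IsRegularDomain Ω S) :
    ∃ a : ℝ, 0 < a ∧ UniformBallCondition Ω S a := by
  obtain ⟨C₀, hC₀⟩ := hR.exists_quadratic_bound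
  set C := max C₀ 1
  have hC1 : 1 ≤ C := le_max_right _ _
  have hC : ∀ p ∈ S, ∀ q ∈ S, |inner ℝ (q - p) (normal Ω S p)| ≤ C * ‖q - p‖ ^ 2 :=
    fun p hp q hq => (hC₀ p hp q hq).trans (by gcongr; exact le_max_left _ _)
  -- With `2aC = 1/2` the cross term absorbs only half of `‖q - p‖²`. The remaining half keeps every
  -- `q ≠ p` outside the closed ball.
  set a := (4 * C)⁻¹ with ha_def
  have ha : 0 < a := by positivity
  have haC : a * C = 1 / 4 := by rw [ha_def]; field_simp
  have key : ∀ p ∈ S, ∀ q ∈ S, ∀ r : ℝ, |r| = a →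
      ‖q - p‖ ^ 2 / 2 + a ^ 2 ≤ ‖q - (p + r • normal Ω S p)‖ ^ 2 := by
    intro p hp q hq r hr
    rw [hR.norm_sub_smul_normal_sq hp, ← sq_abs r, hr]
    have h1 : |2 * r * inner ℝ (q - p) (normal Ω S p)| ≤ ‖q - p‖ ^ 2 / 2 := by
      rw [abs_mul, abs_mul, hr, abs_two]
      calc 2 * a * |inner ℝ (q - p) (normal Ω S p)| ≤ 2 * a * (C * ‖q - p‖ ^ 2) := by
            gcongr; exact hC p hp q hq
        _ = 2 * (a * C) * ‖q - p‖ ^ 2 := by ring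
        _ = ‖q - p‖ ^ 2 / 2 := by rw [haC]; ring
    linarith [le_abs_self (2 * r * inner ℝ (q - p) (normal Ω S p))]
  have hdisj : ∀ p ∈ S, ∀ r : ℝ, |r| = a → Disjoint (ball (p + r • normal Ω S p) a) S := by
    intro p hp r hr
    refine disjoint_left.2 fun q hq hqS => ?_
    rw [mem_ball, dist_eq_norm] at hq
    have h1 := key p hp q hqS r hr
    have h2 := pow_lt_pow_left₀ hq (norm_nonneg _) two_ne_zero
    nlinarith [sq_nonneg ‖q - p‖]
  have hsing : ∀ p ∈ S, ∀ r : ℝ, |r| = a →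
      S ∩ closedBall (p + r • normal Ω S p) a = {p} := by
    intro p hp r hr
    ext q
    simp only [mem_inter_iff, mem_closedBall, mem_singleton_iff, dist_eq_norm]
    constructor
    · rintro ⟨hqS, hq⟩
      have h1 := key p hp q hqS r hr
      have h2 := pow_le_pow_left₀ (norm_nonneg _) hq 2
      have h3 : ‖q - p‖ ^ 2 = 0 := le_antisymm (by linarith) (sq_nonneg _)
      exact sub_eq_zero.1 (norm_eq_zero.1 (pow_eq_zero_iff two_ne_zero |>.1 h3))
    · rintro rfl
      refine ⟨hp, ?_⟩
      rw [sub_add_cancel_left, norm_neg, norm_smul, hR.norm_normal hp, mul_one, Real.norm_eq_abs,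
        hr]
  have habs : |a| = a := abs_of_pos ha
  have habs' : |-a| = a := by rw [abs_neg, habs]
  refine ⟨a, ha, fun p hp => ⟨⟨_, ?_, hsing p hp (-a) habs'⟩, ⟨_, ?_, hsing p hp a habs⟩⟩⟩
  -- The ball misses `S`, so it lies on one side; a point just inside along the normal decides
  -- which.
  · refine (hR.subset_of_isPreconnected (convex_ball _ _).isPreconnected
      (hdisj p hp _ habs')).resolve_right fun h => ?_
    have h1 := eventually_mem_ball_smul ha p (-normal Ω S p) (by rw [norm_neg, hR.norm_normal hp])
    obtain ⟨t, ht1, ht2⟩ := (h1.and (hR.isOuterUnitNormal_normal hp).outward).exists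
    rw [smul_neg, smul_neg, ← neg_smul a, ← sub_eq_add_neg] at ht1
    exact h ht1 (subset_closure ht2.1)
  · refine (hR.subset_of_isPreconnected (convex_ball _ _).isPreconnected
      (hdisj p hp _ habs)).resolve_left fun h => ?_
    have h1 := eventually_mem_ball_smul ha p (normal Ω S p) (hR.norm_normal hp)
    obtain ⟨t, ht1, ht2⟩ := (h1.and (hR.isOuterUnitNormal_normal hp).outward).exists
    exact ht2.2 (subset_closure (h ht1))

end IsRegularDomain

/-! ### Nearest points and the tube, from the ball condition. -/

namespace IsRegularDomain

/-- The segment from a point to a nearest boundary point is normal to the boundary. -/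
lemma exists_eq_smul_normal (hR : IsRegularDomain Ω S) {p y : E m} (hp : p ∈ S)
    (hmin : ∀ q ∈ S, ‖p - y‖ ≤ ‖q - y‖) : ∃ r : ℝ, p - y = r • normal Ω S p := by
  set c := (hR.isC2Hypersurface p hp).some
  have hn := hR.isOuterUnitNormal_normal hp
  refine c.exists_smul_of_orthogonal hn.norm_eq (hn.orthogonal c) fun i => ?_
  have hd : HasFDerivAt c.param (fderiv ℝ c.param 0) 0 :=
    (c.contDiffAt_param.differentiableAt (by norm_num)).hasFDerivAt
  -- The squared distance to `y` along the chart is minimal at `0`; its derivative there is `2 (p -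
  -- y|τᵢ)`.
  have hd2 := (hd.sub_const y).norm_sq
  have hloc : IsLocalMin (fun θ => ‖c.param θ - y‖ ^ 2) 0 := by
    filter_upwards [c.eventually_param_mem] with θ hθ
    rw [c.param_zero]
    exact pow_le_pow_left₀ (norm_nonneg _) (hmin _ hθ) 2
  have h0 := congrArg (fun A : EuclideanSpace ℝ (Fin m) →L[ℝ] ℝ => A (EuclideanSpace.single i 1))
    (hloc.hasFDerivAt_eq_zero hd2)
  simp only [c.param_zero] at h0
  simpa [C2Chart.tau, real_inner_comm, inner_sub_left] using h0

lemma exists_normal_mem_ball (hR : IsRegularDomain Ω S) {p : E m} (hp : p ∈ S) {a : ℝ}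
    (ha : 0 < a) : ∃ t : ℝ, p - t • normal Ω S p ∈ Ω ∧ p + t • normal Ω S p ∉ closure Ω ∧
      p - t • normal Ω S p ∈ ball (p - a • normal Ω S p) a ∧
      p + t • normal Ω S p ∈ ball (p + a • normal Ω S p) a := by
  have h1 := eventually_mem_ball_smul ha p (normal Ω S p) (hR.norm_normal hp)
  have h2 := eventually_mem_ball_smul ha p (-normal Ω S p) (by rw [norm_neg, hR.norm_normal hp])
  simp only [smul_neg, ← sub_eq_add_neg] at h2
  obtain ⟨t, ht1, ht2, ht3⟩ := (h1.and (h2.and (hR.isOuterUnitNormal_normal hp).outward)).exists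
  exact ⟨t, ht3.1, ht3.2, ht2, ht1⟩

section Ball

variable {a : ℝ}

/-- The open ball misses `S` and its closure contains `p`, so `p` is a nearest point to `y` at
distance exactly `a`, and `p - y` is normal. -/
lemma center_eq (hR : IsRegularDomain Ω S) (ha : 0 < a) {p y : E m} (hp : p ∈ S)
    (hdisj : Disjoint (ball y a) S) (hy : S ∩ closedBall y a = {p}) :
    y = p - a • normal Ω S p ∨ y = p + a • normal Ω S p := by
  have hpy : ‖p - y‖ ≤ a := by
    have : p ∈ S ∩ closedBall y a := by rw [hy]; rfl
    simpa [dist_eq_norm] using this.2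
  have hge : ∀ q ∈ S, a ≤ ‖q - y‖ := by
    intro q hq
    by_contra! h
    exact disjoint_left.1 hdisj (by simpa [dist_eq_norm] using h) hq
  obtain ⟨r, hr⟩ := hR.exists_eq_smul_normal hp fun q hq => hpy.trans (hge q hq)
  have hra : |r| = a := by
    have := le_antisymm hpy (hge p hp)
    rwa [hr, norm_smul, hR.norm_normal hp, mul_one, Real.norm_eq_abs] at this
  have hy' : y = p - r • normal Ω S p := by rw [← hr]; abel
  rcases (abs_eq ha.le).1 hra with h | h
  · left; rw [hy', h]
  · right; rw [hy', h, neg_smul, sub_neg_eq_add]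

/-- The interior ball of the ball condition is centered on the inner normal. -/
lemma interior_ball (hR : IsRegularDomain Ω S) (ha : 0 < a) (hB : UniformBallCondition Ω S a)
    {p : E m} (hp : p ∈ S) : ball (p - a • normal Ω S p) a ⊆ Ω ∧
      S ∩ closedBall (p - a • normal Ω S p) a = {p} := by
  obtain ⟨y, hy, hys⟩ := (hB p hp).1
  rcases hR.center_eq ha hp (disjoint_left.2 fun q hq hqS =>
    hR.notMem_of_mem_boundary hqS (hy hq)) hys with rfl | rfl
  · exact ⟨hy, hys⟩
  · obtain ⟨t, -, h2, -, h4⟩ := hR.exists_normal_mem_ball hp ha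
    exact absurd (subset_closure (hy h4)) h2

/-- The exterior ball of the ball condition is centered on the outer normal. -/
lemma exterior_ball (hR : IsRegularDomain Ω S) (ha : 0 < a) (hB : UniformBallCondition Ω S a)
    {p : E m} (hp : p ∈ S) : ball (p + a • normal Ω S p) a ⊆ (closure Ω)ᶜ ∧
      S ∩ closedBall (p + a • normal Ω S p) a = {p} := by
  obtain ⟨y, hy, hys⟩ := (hB p hp).2
  rcases hR.center_eq ha hp (disjoint_left.2 fun q hq hqS =>
    hy hq (hR.mem_closure_of_mem_boundary hqS)) hys with rfl | rfl
  · obtain ⟨t, h1, -, h3, -⟩ := hR.exists_normal_mem_ball hp ha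
    exact absurd (subset_closure h1) (hy h3)
  · exact ⟨hy, hys⟩

/-- A point `q ≠ p` of `S` lies outside both closed tangent balls; expanding the two squared
distances gives the two signs. The constant `2a` is what later allows the full range `|r| < a`. -/
lemma abs_inner_lt (hR : IsRegularDomain Ω S) (ha : 0 < a) (hB : UniformBallCondition Ω S a)
    {p q : E m} (hp : p ∈ S) (hq : q ∈ S) (hqp : q ≠ p) :
    2 * a * |inner ℝ (q - p) (normal Ω S p)| < ‖q - p‖ ^ 2 := by
  have key : ∀ r : ℝ, |r| = a → S ∩ closedBall (p + r • normal Ω S p) a = {p} →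
      2 * r * inner ℝ (q - p) (normal Ω S p) < ‖q - p‖ ^ 2 := by
    intro r hr hs
    have h1 : a < ‖q - (p + r • normal Ω S p)‖ := by
      by_contra! h
      have : q ∈ ({p} : Set (E m)) := by
        rw [← hs]
        exact ⟨hq, by simpa [dist_eq_norm] using h⟩
      exact hqp this
    have h2 := pow_lt_pow_left₀ h1 ha.le two_ne_zero
    rw [hR.norm_sub_smul_normal_sq hp, ← sq_abs r, hr] at h2
    linarith
  have h1 := key a (abs_of_pos ha) (hR.exterior_ball ha hB hp).2
  have h2 := key (-a) (by rw [abs_neg, abs_of_pos ha])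
    (by rw [neg_smul, ← sub_eq_add_neg]; exact (hR.interior_ball ha hB hp).2)
  rcases abs_cases (inner ℝ (q - p) (normal Ω S p)) with h | h <;> rw [h.1] <;> linarith

lemma abs_inner_le (hR : IsRegularDomain Ω S) (ha : 0 < a) (hB : UniformBallCondition Ω S a)
    {p q : E m} (hp : p ∈ S) (hq : q ∈ S) :
    2 * a * |inner ℝ (q - p) (normal Ω S p)| ≤ ‖q - p‖ ^ 2 := by
  by_cases h : q = p
  · simp [h]
  · exact (hR.abs_inner_lt ha hB hp hq h).le

lemma dist_tubeMap (hR : IsRegularDomain Ω S) {p : E m} (hp : p ∈ S) (r : ℝ) :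
    dist (tubeMap Ω S (p, r)) p = |r| := by
  simp [tubeMap, dist_eq_norm, norm_smul, hR.norm_normal hp]

/-- The cross term `2r (q - p|ν)` stays strictly below `‖q - p‖²`, so the squared distance to `q`
exceeds `r²`. Strictness makes the nearest point unique, and the choice in `proj` determinate. -/
lemma lt_dist_tubeMap (hR : IsRegularDomain Ω S) (ha : 0 < a) (hB : UniformBallCondition Ω S a)
    {p q : E m} (hp : p ∈ S) (hq : q ∈ S) (hqp : q ≠ p) {r : ℝ} (hr : r ∈ Ioo (-a) a) :
    |r| < dist (tubeMap Ω S (p, r)) q := by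
  rw [dist_comm, dist_eq_norm]
  refine lt_of_pow_lt_pow_left₀ 2 (norm_nonneg _) ?_
  rw [tubeMap, hR.norm_sub_smul_normal_sq hp, sq_abs]
  have h1 := hR.abs_inner_lt ha hB hp hq hqp
  have h2 : 2 * r * inner ℝ (q - p) (normal Ω S p) ≤
      2 * a * |inner ℝ (q - p) (normal Ω S p)| := by
    calc 2 * r * inner ℝ (q - p) (normal Ω S p)
        ≤ |2 * r * inner ℝ (q - p) (normal Ω S p)| := le_abs_self _
      _ = 2 * |r| * |inner ℝ (q - p) (normal Ω S p)| := by rw [abs_mul, abs_mul, abs_two]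
      _ ≤ 2 * a * |inner ℝ (q - p) (normal Ω S p)| := by
        gcongr; exact (abs_lt.2 ⟨hr.1, hr.2⟩).le
  linarith

lemma infDist_tubeMap (hR : IsRegularDomain Ω S) (ha : 0 < a) (hB : UniformBallCondition Ω S a)
    {p : E m} (hp : p ∈ S) {r : ℝ} (hr : r ∈ Ioo (-a) a) :
    infDist (tubeMap Ω S (p, r)) S = |r| := by
  refine le_antisymm ((infDist_le_dist_of_mem hp).trans (hR.dist_tubeMap hp r).le) ?_
  refine (le_infDist hR.nonempty).2 fun q hq => ?_
  by_cases h : q = p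
  · rw [h, hR.dist_tubeMap hp]
  · exact (hR.lt_dist_tubeMap ha hB hp hq h hr).le

lemma eq_of_dist_tubeMap (hR : IsRegularDomain Ω S) (ha : 0 < a)
    (hB : UniformBallCondition Ω S a) {p q : E m} (hp : p ∈ S) (hq : q ∈ S) {r : ℝ}
    (hr : r ∈ Ioo (-a) a) (h : dist (tubeMap Ω S (p, r)) q = infDist (tubeMap Ω S (p, r)) S) :
    q = p := by
  by_contra hqp
  have := hR.lt_dist_tubeMap ha hB hp hq hqp hr
  rw [h, hR.infDist_tubeMap ha hB hp hr] at this
  exact lt_irrefl _ this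

lemma proj_tubeMap (hR : IsRegularDomain Ω S) (ha : 0 < a) (hB : UniformBallCondition Ω S a)
    {p : E m} (hp : p ∈ S) {r : ℝ} (hr : r ∈ Ioo (-a) a) :
    proj S (tubeMap Ω S (p, r)) = p := by
  have h := Classical.epsilon_spec (p := fun q => q ∈ S ∧
    dist (tubeMap Ω S (p, r)) q = infDist (tubeMap Ω S (p, r)) S)
    ⟨p, hp, by rw [hR.dist_tubeMap hp, hR.infDist_tubeMap ha hB hp hr]⟩
  exact hR.eq_of_dist_tubeMap ha hB hp h.1 hr h.2

/-- The sign comes from the tangent ball containing the point: for `r < 0` the interior one, for `r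
> 0` the exterior one. -/
lemma signedDist_tubeMap (hR : IsRegularDomain Ω S) (ha : 0 < a)
    (hB : UniformBallCondition Ω S a) {p : E m} (hp : p ∈ S) {r : ℝ} (hr : r ∈ Ioo (-a) a) :
    signedDist Ω S (tubeMap Ω S (p, r)) = r := by
  rw [signedDist, hR.infDist_tubeMap ha hB hp hr]
  have hmem : ∀ s : ℝ, |r - s| < a →
      tubeMap Ω S (p, r) ∈ ball (p + s • normal Ω S p) a := by
    intro s hs
    rwa [mem_ball, dist_eq_norm, tubeMap, add_sub_add_left_eq_sub, ← sub_smul, norm_smul,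
      hR.norm_normal hp, mul_one, Real.norm_eq_abs]
  rcases lt_trichotomy r 0 with h | h | h
  · rw [if_pos, abs_of_neg h, neg_neg]
    apply (hR.interior_ball ha hB hp).1
    rw [sub_eq_add_neg, ← neg_smul]
    exact hmem _ (abs_lt.2 ⟨by linarith [hr.1], by linarith⟩)
  · simp [h]
  · rw [if_neg, abs_of_pos h]
    intro hc
    exact (hR.exterior_ball ha hB hp).1 (hmem _
      (abs_lt.2 ⟨by linarith, by linarith [hr.2]⟩)) (subset_closure hc)

lemma injOn_tubeMap (hR : IsRegularDomain Ω S) (ha : 0 < a) (hB : UniformBallCondition Ω S a) :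
    InjOn (tubeMap Ω S) (S ×ˢ Ioo (-a) a) := by
  rintro ⟨p, r⟩ ⟨hp, hr⟩ ⟨q, s⟩ ⟨hq, hs⟩ h
  have h1 := hR.proj_tubeMap ha hB hp hr
  have h2 := hR.signedDist_tubeMap ha hB hp hr
  rw [h] at h1 h2
  exact Prod.ext (h1.symm.trans (hR.proj_tubeMap ha hB hq hs))
    (h2.symm.trans (hR.signedDist_tubeMap ha hB hq hs))

lemma tube_eq (hR : IsRegularDomain Ω S) (ha : 0 < a) (hB : UniformBallCondition Ω S a) :
    tube Ω S a = {x | infDist x S < a} := by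
  ext x
  constructor
  · rintro ⟨⟨p, r⟩, ⟨hp, hr⟩, rfl⟩
    rw [mem_ofPred_eq, hR.infDist_tubeMap ha hB hp hr]
    exact abs_lt.2 hr
  · intro hx
    obtain ⟨p, hp, hxp⟩ := hR.isCompact.exists_infDist_eq_dist hR.nonempty x
    -- A nearest point exists by compactness, and the segment to it is normal. Here `p - x = r ν`,
    -- so the tube parameter of `x` is `-r`.
    obtain ⟨r, hr⟩ := hR.exists_eq_smul_normal hp (y := x) fun q hq => by
      rw [← dist_eq_norm, ← dist_eq_norm, dist_comm p, dist_comm q, ← hxp]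
      exact infDist_le_dist_of_mem hq
    have hx' : infDist x S < a := hx
    rw [hxp, dist_comm, dist_eq_norm, hr, norm_smul, hR.norm_normal hp, mul_one,
      Real.norm_eq_abs] at hx'
    refine ⟨(p, -r), ⟨hp, abs_lt.1 (by simpa using hx')⟩, ?_⟩
    rw [tubeMap, neg_smul, ← hr]
    simp

lemma isOpen_tube (hR : IsRegularDomain Ω S) (ha : 0 < a) (hB : UniformBallCondition Ω S a) :
    IsOpen (tube Ω S a) := by
  rw [hR.tube_eq ha hB]
  exact isOpen_lt (continuous_infDist_pt S) continuous_const

end Ball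

end IsRegularDomain

/-! ### Curvature bound and differentiability of the projection and signed distance. -/

namespace IsDefiningFunction

variable {W : Set (E m)} {f : E m → ℝ}

lemma contDiffAt_unitGradient (hf : IsDefiningFunction Ω S W f) {x : E m} (hx : x ∈ W) :
    ContDiffAt ℝ 1 (unitGradient f) x :=
  hf.contDiffOn_unitGradient.contDiffAt (hf.isOpen.mem_nhds hx)

lemma hasFDerivAt_unitGradient (hf : IsDefiningFunction Ω S W f) {x : E m} (hx : x ∈ W) :
    HasFDerivAt (unitGradient f) (fderiv ℝ (unitGradient f) x) x :=
  ((hf.contDiffAt_unitGradient hx).differentiableAt (by norm_num)).hasFDerivAt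

/-- `‖N‖² = 1` holds on an open set, so it may be differentiated in every direction, not only
tangentially. -/
lemma inner_fderiv_unitGradient (hf : IsDefiningFunction Ω S W f) {x : E m} (hx : x ∈ W)
    (v : E m) : inner ℝ (unitGradient f x) (fderiv ℝ (unitGradient f) x v) = 0 := by
  have h1 := (hf.hasFDerivAt_unitGradient hx).norm_sq
  have h2 : HasFDerivAt (fun y => ‖unitGradient f y‖ ^ 2) (0 : E m →L[ℝ] ℝ) x := by
    refine (hasFDerivAt_const (1 : ℝ) x).congr_of_eventuallyEq ?_
    filter_upwards [hf.isOpen.mem_nhds hx] with y hy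
    rw [hf.norm_unitGradient hy, one_pow]
  have h3 := congrArg (fun A : E m →L[ℝ] ℝ => A v) (h1.unique h2)
  simpa using h3

end IsDefiningFunction

lemma C2Chart.hasFDerivAt_param {p : E m} (c : C2Chart S p) :
    HasFDerivAt c.param (fderiv ℝ c.param 0) 0 :=
  (c.contDiffAt_param.differentiableAt (by norm_num)).hasFDerivAt

namespace IsRegularDomain

variable {a : ℝ} {W : Set (E m)} {f : E m → ℝ} {p : E m}

/-- The ball condition bounds the curvature of the boundary. -/
lemma abs_inner_fderiv_unitGradient_le (hR : IsRegularDomain Ω S) (ha : 0 < a)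
    (hB : UniformBallCondition Ω S a) (hf : IsDefiningFunction Ω S W f) (hp : p ∈ S) (hpW : p ∈ W)
    {v : E m} (hv : inner ℝ (normal Ω S p) v = 0) :
    a * |inner ℝ v (fderiv ℝ (unitGradient f) p v)| ≤ ‖v‖ ^ 2 := by
  set c := (hR.isC2Hypersurface p hp).some
  have hn := hR.isOuterUnitNormal_normal hp
  obtain ⟨θ, rfl⟩ := c.exists_fderiv_param_eq hn.norm_eq (hn.orthogonal c) hv
  set g : ℝ → E m := fun t => c.param (t • θ) with hg
  have hg0 : g 0 = p := by simp [hg, c.param_zero]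
  have hline : HasDerivAt (fun t : ℝ => t • θ) θ 0 := by
    simpa using (hasDerivAt_id (0 : ℝ)).smul_const θ
  have hgd : HasDerivAt g (fderiv ℝ c.param 0 θ) 0 := by
    have h : HasFDerivAt c.param (fderiv ℝ c.param 0) ((0 : ℝ) • θ) := by
      rw [zero_smul]; exact c.hasFDerivAt_param
    exact h.comp_hasDerivAt _ hline
  have hkd : HasDerivAt (unitGradient f ∘ g)
      (fderiv ℝ (unitGradient f) p (fderiv ℝ c.param 0 θ)) 0 := by
    refine HasFDerivAt.comp_hasDerivAt (l := unitGradient f) _ ?_ hgd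
    rw [hg0]
    exact hf.hasFDerivAt_unitGradient hpW
  have hgS : ∀ᶠ t in 𝓝 (0 : ℝ), g t ∈ S := by
    refine hline.continuousAt.eventually (p := fun z => c.param z ∈ S) ?_
    simpa using c.eventually_param_mem
  have hgW : ∀ᶠ t in 𝓝 (0 : ℝ), g t ∈ W :=
    hgd.continuousAt.eventually_mem (hf.isOpen.mem_nhds (by rwa [hg0]))
  refine le_of_tendsto_of_tendsto
    (((hgd.tendsto_slope.inner hkd.tendsto_slope).abs).const_mul a)
    (hgd.tendsto_slope.norm.pow 2) ?_
  filter_upwards [nhdsWithin_le_nhds hgS, nhdsWithin_le_nhds hgW] with t htS htW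
  -- The chord from `p` to `g t` is tested against the normals at both ends. Subtracting the inner
  -- products halves `2a` to `a`; dividing by `t²` and letting `t → 0` gives the claim.
  have h1 := hR.abs_inner_le ha hB hp htS
  have h2 := hR.abs_inner_le ha hB htS hp
  rw [hR.normal_eq_unitGradient hf hp hpW] at h1
  rw [hR.normal_eq_unitGradient hf htS htW, norm_sub_rev, ← neg_sub, inner_neg_left,
    abs_neg] at h2
  have h3 : a * |inner ℝ (g t - p) (unitGradient f (g t) - unitGradient f p)| ≤ ‖g t - p‖ ^ 2 := by
    rw [inner_sub_right]
    have := abs_sub (inner ℝ (g t - p) (unitGradient f (g t)))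
      (inner ℝ (g t - p) (unitGradient f p))
    nlinarith
  simp only [slope_def_module, sub_zero, Function.comp_apply, hg0, inner_smul_left,
    inner_smul_right, norm_smul, mul_pow, abs_mul, norm_inv, Real.norm_eq_abs, conj_trivial]
  calc a * (|t⁻¹| * (|t⁻¹| * |inner ℝ (g t - p) (unitGradient f (g t) - unitGradient f p)|))
      = |t⁻¹| ^ 2 * (a * |inner ℝ (g t - p) (unitGradient f (g t) - unitGradient f p)|) := by ring
    _ ≤ |t⁻¹| ^ 2 * ‖g t - p‖ ^ 2 := by gcongr
    _ = |t|⁻¹ ^ 2 * ‖g t - p‖ ^ 2 := by rw [abs_inv]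

/-- Pairing with `v` gives `‖v‖² = -r (v|N'v)`, while the curvature bound and `|r| < a` make the
right side smaller than `‖v‖²` unless `v = 0`. -/
lemma eq_zero_of_add_smul_fderiv (hR : IsRegularDomain Ω S) (ha : 0 < a)
    (hB : UniformBallCondition Ω S a) (hf : IsDefiningFunction Ω S W f) (hp : p ∈ S) (hpW : p ∈ W)
    {r : ℝ} (hr : r ∈ Ioo (-a) a) {v : E m} (hv : inner ℝ (normal Ω S p) v = 0)
    (h : v + r • fderiv ℝ (unitGradient f) p v = 0) : v = 0 := by
  have h1 := hR.abs_inner_fderiv_unitGradient_le ha hB hf hp hpW hv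
  have h2 : ‖v‖ ^ 2 + r * inner ℝ v (fderiv ℝ (unitGradient f) p v) = 0 := by
    rw [← real_inner_self_eq_norm_sq, ← inner_smul_right, ← inner_add_right, h, inner_zero_right]
  by_contra hv0
  have hpos : 0 < ‖v‖ ^ 2 := by positivity
  set J := inner ℝ v (fderiv ℝ (unitGradient f) p v)
  have hra : |r| < a := abs_lt.2 hr
  have h3 : ‖v‖ ^ 2 ≤ |r| * |J| := by
    rw [← abs_mul]
    linarith [neg_abs_le (r * J)]
  have hJ : 0 < |J| := by
    by_contra! hJ
    nlinarith [abs_nonneg r, abs_nonneg J]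
  nlinarith

/-- The normal coordinates associated with a chart. -/
def normalCoord (c : C2Chart S p) (f : E m → ℝ) (z : EuclideanSpace ℝ (Fin m) × ℝ) : E m :=
  c.param z.1 + z.2 • unitGradient f (c.param z.1)

lemma hasFDerivAt_normalCoord (hf : IsDefiningFunction Ω S W f) (hpW : p ∈ W)
    (c : C2Chart S p) (r : ℝ) :
    ∃ A : EuclideanSpace ℝ (Fin m) × ℝ →L[ℝ] E m, HasFDerivAt (normalCoord c f) A (0, r) ∧
      ∀ z, A z = fderiv ℝ c.param 0 z.1 + (r • fderiv ℝ (unitGradient f) p (fderiv ℝ c.param 0 z.1)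
        + z.2 • unitGradient f p) := by
  have h1 : HasFDerivAt (fun z : EuclideanSpace ℝ (Fin m) × ℝ => c.param z.1)
      (fderiv ℝ c.param 0 ∘L ContinuousLinearMap.fst ℝ _ _) (0, r) :=
    HasFDerivAt.comp (g := c.param) (0, r) c.hasFDerivAt_param hasFDerivAt_fst
  have h2 : HasFDerivAt (fun z : EuclideanSpace ℝ (Fin m) × ℝ => unitGradient f (c.param z.1))
      (fderiv ℝ (unitGradient f) p ∘L (fderiv ℝ c.param 0 ∘L ContinuousLinearMap.fst ℝ _ _))
      (0, r) := by
    refine HasFDerivAt.comp (g := unitGradient f) (0, r) ?_ h1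
    rw [c.param_zero]
    exact hf.hasFDerivAt_unitGradient hpW
  have h3 := h1.add ((hasFDerivAt_snd (𝕜 := ℝ) (E := EuclideanSpace ℝ (Fin m)) (F := ℝ)
    (p := (0, r))).smul h2)
  refine ⟨_, h3, fun z => ?_⟩
  simp [c.param_zero]

/-- The nearest point projection and the signed distance are continuously differentiable. -/
lemma contDiffAt_proj_signedDist (hR : IsRegularDomain Ω S) (ha : 0 < a)
    (hB : UniformBallCondition Ω S a) (hp : p ∈ S) {r : ℝ} (hr : r ∈ Ioo (-a) a) :
    ContDiffAt ℝ 1 (proj S) (tubeMap Ω S (p, r)) ∧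
      ContDiffAt ℝ 1 (signedDist Ω S) (tubeMap Ω S (p, r)) := by
  obtain ⟨W, f, hpW, hf⟩ := hR.exists_definingFunction p hp
  set c := (hR.isC2Hypersurface p hp).some
  have hn := hR.isOuterUnitNormal_normal hp
  have hnp := hR.normal_eq_unitGradient hf hp hpW
  obtain ⟨A, hA, hAz⟩ := hasFDerivAt_normalCoord hf hpW c r
  -- The normal component of `A (θ, s) = 0` is `s = 0`; the tangential rest is killed by the
  -- curvature bound.
  have hinj : Function.Injective A := by
    rw [injective_iff_map_eq_zero]
    rintro ⟨θ, s⟩ hz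
    rw [hAz] at hz
    simp only at hz
    have hv : inner ℝ (normal Ω S p) (fderiv ℝ c.param 0 θ) = 0 := by
      rw [c.fderiv_param_apply, inner_sum]
      refine Finset.sum_eq_zero fun i _ => ?_
      rw [inner_smul_right, real_inner_comm, hn.orthogonal c, mul_zero]
    have hs : s = 0 := by
      have h := congrArg (fun w => inner ℝ (unitGradient f p) w) hz
      simp only [inner_add_right, inner_smul_right, ← hnp, hv, real_inner_self_eq_norm_sq, hn.norm_eq, inner_zero_right] at h
      rw [hnp, hf.inner_fderiv_unitGradient hpW] at h
      linarith
    rw [hs, zero_smul, add_zero] at hz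
    have hv0 := hR.eq_zero_of_add_smul_fderiv ha hB hf hp hpW hr hv hz
    have hθ : θ = 0 := c.fderiv_param_injective (by rw [hv0, map_zero])
    rw [hθ, hs]
    rfl
  have hfin : finrank ℝ (EuclideanSpace ℝ (Fin m) × ℝ) = finrank ℝ (E m) := by simp
  set e : (EuclideanSpace ℝ (Fin m) × ℝ) ≃L[ℝ] E m :=
    (LinearEquiv.ofInjectiveOfFinrankEq A.toLinearMap hinj hfin).toContinuousLinearEquiv
  have hA' : HasFDerivAt (normalCoord c f) (e : EuclideanSpace ℝ (Fin m) × ℝ →L[ℝ] E m)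
      (0, r) := by
    have : (e : EuclideanSpace ℝ (Fin m) × ℝ →L[ℝ] E m) = A := by
      ext z <;> rfl
    rwa [this]
  have hparam : ContDiffAt ℝ 1 (fun z : EuclideanSpace ℝ (Fin m) × ℝ => c.param z.1) (0, r) :=
    ContDiffAt.comp (g := c.param) (0, r) (c.contDiffAt_param.of_le (by norm_num)) contDiffAt_fst
  have hC : ContDiffAt ℝ 1 (normalCoord c f) (0, r) := by
    refine hparam.add (contDiffAt_snd.smul ?_)
    refine ContDiffAt.comp (g := unitGradient f) (0, r) ?_ hparam
    rw [c.param_zero]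
    exact hf.contDiffAt_unitGradient hpW
  have hx : normalCoord c f (0, r) = tubeMap Ω S (p, r) := by
    simp [normalCoord, tubeMap, c.param_zero, hnp]
  set G := hC.localInverse hA' one_ne_zero
  have hG : ContDiffAt ℝ 1 G (tubeMap Ω S (p, r)) := hx ▸ hC.to_localInverse hA' one_ne_zero
  have hG0 : G (tubeMap Ω S (p, r)) = (0, r) := hx ▸ hC.localInverse_apply_image hA' one_ne_zero
  have hGr : ∀ᶠ x in 𝓝 (tubeMap Ω S (p, r)), normalCoord c f (G x) = x :=
    hx ▸ (hC.hasStrictFDerivAt' hA' one_ne_zero).eventually_right_inverse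
  have hev : ∀ᶠ z : EuclideanSpace ℝ (Fin m) × ℝ in 𝓝 (0, r),
      c.param z.1 ∈ S ∧ c.param z.1 ∈ W ∧ z.2 ∈ Ioo (-a) a := by
    refine ((continuousAt_fst (p := ((0 : EuclideanSpace ℝ (Fin m)), r))).eventually
      c.eventually_param_mem).and (.and ?_ ?_)
    · exact hparam.continuousAt.eventually_mem (hf.isOpen.mem_nhds (by rwa [c.param_zero]))
    · exact continuousAt_snd.eventually_mem (Ioo_mem_nhds hr.1 hr.2)
  have hev' := hG.continuousAt.eventually (p := fun z => c.param z.1 ∈ S ∧ c.param z.1 ∈ W ∧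
    z.2 ∈ Ioo (-a) a) (by rw [hG0]; exact hev)
  -- Where `φ(θ) ∈ S ∩ W` and `|r| < a`, normal coordinates agree with the tube map, so the local
  -- inverse `G` computes the globally defined `proj` and `signedDist`.
  have heq : ∀ᶠ x in 𝓝 (tubeMap Ω S (p, r)),
      proj S x = c.param (G x).1 ∧ signedDist Ω S x = (G x).2 := by
    filter_upwards [hGr, hev'] with x h1 h2
    have h3 : tubeMap Ω S (c.param (G x).1, (G x).2) = x := by
      rw [tubeMap, hR.normal_eq_unitGradient hf h2.1 h2.2.1]
      exact h1
    have h4 := hR.proj_tubeMap ha hB h2.1 h2.2.2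
    have h5 := hR.signedDist_tubeMap ha hB h2.1 h2.2.2
    rw [h3] at h4 h5
    exact ⟨h4, h5⟩
  refine ⟨?_, ?_⟩
  · refine ContDiffAt.congr_of_eventuallyEq ?_ (heq.mono fun x h => h.1)
    exact ContDiffAt.comp (g := fun z : EuclideanSpace ℝ (Fin m) × ℝ => c.param z.1) _
      (by rw [hG0]; exact hparam) hG
  · exact (ContDiffAt.snd hG).congr_of_eventuallyEq (heq.mono fun x h => h.2)

lemma tubeMap_proj_signedDist (hR : IsRegularDomain Ω S) (ha : 0 < a)
    (hB : UniformBallCondition Ω S a) {x : E m} (hx : x ∈ tube Ω S a) :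
    proj S x ∈ S ∧ signedDist Ω S x ∈ Ioo (-a) a ∧
      tubeMap Ω S (proj S x, signedDist Ω S x) = x := by
  obtain ⟨⟨p, r⟩, ⟨hp, hr⟩, rfl⟩ := hx
  rw [hR.proj_tubeMap ha hB hp hr, hR.signedDist_tubeMap ha hB hp hr]
  exact ⟨hp, hr, rfl⟩

lemma contDiffAt_proj (hR : IsRegularDomain Ω S) (ha : 0 < a) (hB : UniformBallCondition Ω S a)
    {x : E m} (hx : x ∈ tube Ω S a) : ContDiffAt ℝ 1 (proj S) x := by
  obtain ⟨⟨p, r⟩, ⟨hp, hr⟩, rfl⟩ := hx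
  exact (hR.contDiffAt_proj_signedDist ha hB hp hr).1

lemma hasFDerivAt_proj_fderiv (hR : IsRegularDomain Ω S) (ha : 0 < a)
    (hB : UniformBallCondition Ω S a) {x : E m} (hx : x ∈ tube Ω S a) :
    HasFDerivAt (proj S) (fderiv ℝ (proj S) x) x :=
  ((hR.contDiffAt_proj ha hB hx).differentiableAt (by norm_num)).hasFDerivAt

lemma hasFDerivAt_signedDist_fderiv (hR : IsRegularDomain Ω S) (ha : 0 < a)
    (hB : UniformBallCondition Ω S a) {x : E m} (hx : x ∈ tube Ω S a) :
    HasFDerivAt (signedDist Ω S) (fderiv ℝ (signedDist Ω S) x) x := by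
  obtain ⟨⟨p, r⟩, ⟨hp, hr⟩, rfl⟩ := hx
  exact ((hR.contDiffAt_proj_signedDist ha hB hp hr).2.differentiableAt (by norm_num)).hasFDerivAt

/-! ### Gradient and `C²` regularity of the signed distance. -/

/-- Near a point of the tube the normal at the projection is given by a defining function. -/
lemma eventually_normal_proj (hR : IsRegularDomain Ω S) (ha : 0 < a)
    (hB : UniformBallCondition Ω S a) (hf : IsDefiningFunction Ω S W f) {x : E m}
    (hx : x ∈ tube Ω S a) (hxW : proj S x ∈ W) :
    ∀ᶠ y in 𝓝 x, normal Ω S (proj S y) = unitGradient f (proj S y) := by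
  filter_upwards [(hR.isOpen_tube ha hB).mem_nhds hx,
    (hR.contDiffAt_proj ha hB hx).continuousAt.eventually_mem (hf.isOpen.mem_nhds hxW)]
    with y hy hyW
  exact hR.normal_eq_unitGradient hf (hR.tubeMap_proj_signedDist ha hB hy).1 hyW

lemma inner_normal_fderiv_proj (hR : IsRegularDomain Ω S) (ha : 0 < a)
    (hB : UniformBallCondition Ω S a) {x : E m} (hx : x ∈ tube Ω S a) (h : E m) :
    inner ℝ (normal Ω S (proj S x)) (fderiv ℝ (proj S) x h) = 0 := by
  have hp := (hR.tubeMap_proj_signedDist ha hB hx).1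
  obtain ⟨W, f, hpW, hf⟩ := hR.exists_definingFunction _ hp
  rw [hR.normal_eq_unitGradient hf hp hpW]
  refine hf.inner_unitGradient_eq_zero (hR.hasFDerivAt_proj_fderiv ha hB hx) ?_ hpW h
  filter_upwards [(hR.isOpen_tube ha hB).mem_nhds hx] with y hy
  exact (hR.tubeMap_proj_signedDist ha hB hy).1

/-- The differentiated identity `x = Π(x) + d(x) ν(Π(x))`. -/
lemma decomposition (hR : IsRegularDomain Ω S) (ha : 0 < a) (hB : UniformBallCondition Ω S a)
    (hf : IsDefiningFunction Ω S W f) {x : E m} (hx : x ∈ tube Ω S a) (hxW : proj S x ∈ W)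
    (h : E m) :
    h = fderiv ℝ (proj S) x h + (signedDist Ω S x •
      fderiv ℝ (unitGradient f) (proj S x) (fderiv ℝ (proj S) x h) +
      fderiv ℝ (signedDist Ω S) x h • normal Ω S (proj S x)) := by
  have h1 := hR.hasFDerivAt_proj_fderiv ha hB hx
  have h2 := (hf.hasFDerivAt_unitGradient hxW).comp x h1
  have h3 := h1.add ((hR.hasFDerivAt_signedDist_fderiv ha hB hx).smul h2)
  have h4 : HasFDerivAt (proj S + signedDist Ω S • (unitGradient f ∘ proj S))
      (ContinuousLinearMap.id ℝ (E m)) x := by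
    refine (hasFDerivAt_id x).congr_of_eventuallyEq ?_
    filter_upwards [(hR.isOpen_tube ha hB).mem_nhds hx,
      hR.eventually_normal_proj ha hB hf hx hxW] with y hy hyn
    have := (hR.tubeMap_proj_signedDist ha hB hy).2.2
    rw [tubeMap, hyn] at this
    exact this
  have h5 := congrArg (fun A : E m →L[ℝ] E m => A h) (h3.unique h4)
  rw [(hR.eventually_normal_proj ha hB hf hx hxW).self_of_nhds]
  simpa using h5.symm

/-- In `decomposition` the terms with `Π'` and `N'` are orthogonal to `ν`, so pairing with `ν`
leaves only the derivative of `d`. -/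
lemma hasGradientAt_signedDist (hR : IsRegularDomain Ω S) (ha : 0 < a)
    (hB : UniformBallCondition Ω S a) {x : E m} (hx : x ∈ tube Ω S a) :
    HasGradientAt (signedDist Ω S) (normal Ω S (proj S x)) x := by
  have hp := (hR.tubeMap_proj_signedDist ha hB hx).1
  obtain ⟨W, f, hpW, hf⟩ := hR.exists_definingFunction _ hp
  rw [hasGradientAt_iff_hasFDerivAt]
  suffices h : InnerProductSpace.toDual ℝ (E m) (normal Ω S (proj S x)) =
      fderiv ℝ (signedDist Ω S) x from h ▸ hR.hasFDerivAt_signedDist_fderiv ha hB hx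
  refine ContinuousLinearMap.ext fun h => ?_
  rw [InnerProductSpace.toDual_apply_apply]
  conv_lhs => rw [hR.decomposition ha hB hf hx hpW h]
  rw [inner_add_right, inner_add_right, inner_smul_right, inner_smul_right,
    hR.inner_normal_fderiv_proj ha hB hx, real_inner_self_eq_norm_sq, hR.norm_normal hp,
    hR.normal_eq_unitGradient hf hp hpW, hf.inner_fderiv_unitGradient hpW]
  ring

lemma fderiv_signedDist (hR : IsRegularDomain Ω S) (ha : 0 < a)
    (hB : UniformBallCondition Ω S a) {x : E m} (hx : x ∈ tube Ω S a) :
    fderiv ℝ (signedDist Ω S) x = InnerProductSpace.toDual ℝ (E m) (normal Ω S (proj S x)) :=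
  (hR.hasGradientAt_signedDist ha hB hx).hasFDerivAt.fderiv

/-- One derivative is gained: the differential is dual to `ν ∘ Π`, which is locally the composition
of the `C¹` maps `N` and `Π`. -/
lemma contDiffOn_signedDist (hR : IsRegularDomain Ω S) (ha : 0 < a)
    (hB : UniformBallCondition Ω S a) : ContDiffOn ℝ 2 (signedDist Ω S) (tube Ω S a) := by
  rw [show (2 : WithTop ℕ∞) = 1 + 1 by norm_num,
    contDiffOn_succ_iff_fderiv_of_isOpen (hR.isOpen_tube ha hB)]
  refine ⟨fun x hx =>
    (hR.hasFDerivAt_signedDist_fderiv ha hB hx).differentiableAt.differentiableWithinAt,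
    by simp, fun x hx => ContDiffAt.contDiffWithinAt ?_⟩
  obtain ⟨W, f, hpW, hf⟩ :=
    hR.exists_definingFunction _ (hR.tubeMap_proj_signedDist ha hB hx).1
  have h1 : ContDiffAt ℝ 1 (fun y => unitGradient f (proj S y)) x :=
    ContDiffAt.comp (g := unitGradient f) x (hf.contDiffAt_unitGradient hpW)
      (hR.contDiffAt_proj ha hB hx)
  have h2 := (InnerProductSpace.toDual ℝ (E m)).toContinuousLinearEquiv.contDiff.contDiffAt.comp
    x h1
  refine h2.congr_of_eventuallyEq ?_
  filter_upwards [(hR.isOpen_tube ha hB).mem_nhds hx,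
    hR.eventually_normal_proj ha hB hf hx hpW] with y hy hyn
  rw [hR.fderiv_signedDist ha hB hy, hyn]
  rfl

end IsRegularDomain

/-! ### The Weingarten tensor as minus the derivative of the normal. -/

section Chart

variable {p : E m}

namespace C2Chart

lemma isUnit_det_firstForm (c : C2Chart S p) : IsUnit c.firstForm.det := by
  have h := (Matrix.posDef_gram_of_linearIndependent c.linearIndependent_tau).det_pos
  exact isUnit_iff_ne_zero.2 h.ne'

lemma inner_dualTau_tau (c : C2Chart S p) (i j : Fin m) :
    inner ℝ (c.dualTau i) (c.tau j) = if i = j then 1 else 0 := by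
  have h := congrFun (congrFun (Matrix.nonsing_inv_mul c.firstForm c.isUnit_det_firstForm) i) j
  rw [Matrix.mul_apply, Matrix.one_apply] at h
  rw [← h, dualTau, sum_inner]
  simp [inner_smul_left, firstForm]

lemma inner_dualTau_normal (c : C2Chart S p) {v : E m} (hv : ∀ i, inner ℝ (c.tau i) v = 0)
    (i : Fin m) : inner ℝ (c.dualTau i) v = 0 := by
  simp [dualTau, sum_inner, inner_smul_left, hv]

lemma weingarten_apply (c : C2Chart S p) (ν x : E m) :
    c.weingarten ν x =
      ∑ i, ∑ j, (c.secondForm ν i j * inner ℝ (c.dualTau j) x) • c.dualTau i := by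
  simp [weingarten, InnerProductSpace.rankOne_apply, smul_smul]

lemma tau2_eq (c : C2Chart S p) (i j : Fin m) :
    c.tau2 i j = fderiv ℝ (fderiv ℝ c.param) 0 (EuclideanSpace.single i 1)
      (EuclideanSpace.single j 1) := by
  have h : HasFDerivAt (fderiv ℝ c.param) (fderiv ℝ (fderiv ℝ c.param) 0) 0 :=
    ((c.contDiffAt_param.fderiv_right (m := 1) (by norm_num)).differentiableAt
      (by norm_num)).hasFDerivAt
  have h2 := h.clm_apply (hasFDerivAt_const (EuclideanSpace.single j (1 : ℝ)) 0)
  rw [tau2, h2.fderiv]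
  simp

lemma secondForm_symm (c : C2Chart S p) (ν : E m) (i j : Fin m) :
    c.secondForm ν i j = c.secondForm ν j i := by
  have h : IsSymmSndFDerivAt ℝ c.param 0 := c.contDiffAt_param.isSymmSndFDerivAt (by simp)
  simp only [secondForm, Matrix.of_apply, tau2_eq]
  rw [h.eq]

lemma weingarten_isSymmetric (c : C2Chart S p) (ν : E m) :
    (c.weingarten ν).toLinearMap.IsSymmetric := by
  intro x y
  simp only [ContinuousLinearMap.coe_coe, weingarten_apply, sum_inner, inner_sum, inner_smul_left,
    inner_smul_right, conj_trivial]
  rw [Finset.sum_comm]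
  refine Finset.sum_congr rfl fun i _ => Finset.sum_congr rfl fun j _ => ?_
  rw [c.secondForm_symm ν j i, real_inner_comm x]
  ring

lemma weingarten_normal (c : C2Chart S p) {ν : E m} (hν : ∀ i, inner ℝ (c.tau i) ν = 0) :
    c.weingarten ν ν = 0 := by
  simp [weingarten_apply, c.inner_dualTau_normal hν]

lemma inner_normal_weingarten (c : C2Chart S p) {ν : E m} (hν : ∀ i, inner ℝ (c.tau i) ν = 0)
    (x : E m) : inner ℝ ν (c.weingarten ν x) = 0 := by
  have h := c.weingarten_isSymmetric ν ν x
  simp only [ContinuousLinearMap.coe_coe] at h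
  rw [← h, c.weingarten_normal hν, inner_zero_left]

lemma weingarten_tau (c : C2Chart S p) (ν : E m) (j : Fin m) :
    c.weingarten ν (c.tau j) = ∑ i, c.secondForm ν i j • c.dualTau i := by
  simp [weingarten_apply, inner_dualTau_tau]

/-- Makes `K` the matrix of `L` restricted to the tangent space in the basis `τ`; symmetry of `G⁻¹`
matches the index order in `dualTau` with that in `shapeMatrix`. -/
lemma weingarten_tau_eq_shapeMatrix (c : C2Chart S p) (ν : E m) (j : Fin m) :
    c.weingarten ν (c.tau j) = ∑ k, c.shapeMatrix ν k j • c.tau k := by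
  have hs : ∀ i k, c.firstForm⁻¹ i k = c.firstForm⁻¹ k i := by
    have h : c.firstForm.transpose = c.firstForm := by
      ext i k
      simp [firstForm, real_inner_comm]
    intro i k
    conv_lhs => rw [← h, ← Matrix.transpose_nonsing_inv]
    rfl
  rw [weingarten_tau]
  simp only [dualTau, shapeMatrix, Matrix.mul_apply, Finset.smul_sum, Finset.sum_smul, smul_smul]
  rw [Finset.sum_comm]
  refine Finset.sum_congr rfl fun k _ => Finset.sum_congr rfl fun i _ => ?_
  rw [hs i k, mul_comm]

variable {W : Set (E m)} {f : E m → ℝ}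

/-- The second fundamental form is given by the derivative of the normal. -/
lemma secondForm_eq (c : C2Chart S p) (hf : IsDefiningFunction Ω S W f) (hpW : p ∈ W)
    (i j : Fin m) : c.secondForm (unitGradient f p) i j =
      -inner ℝ (fderiv ℝ (unitGradient f) p (c.tau i)) (c.tau j) := by
  have hN : HasFDerivAt (fun θ => unitGradient f (c.param θ))
      (fderiv ℝ (unitGradient f) p ∘L fderiv ℝ c.param 0) 0 := by
    refine HasFDerivAt.comp (g := unitGradient f) 0 ?_ c.hasFDerivAt_param
    rw [c.param_zero]
    exact hf.hasFDerivAt_unitGradient hpW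
  have h2 : HasFDerivAt (fderiv ℝ c.param) (fderiv ℝ (fderiv ℝ c.param) 0) 0 :=
    ((c.contDiffAt_param.fderiv_right (m := 1) (by norm_num)).differentiableAt
      (by norm_num)).hasFDerivAt
  have h3 := h2.clm_apply (hasFDerivAt_const (EuclideanSpace.single j (1 : ℝ)) 0)
  have h3 := hN.inner ℝ h3
  -- `(N ∘ φ | ∂ⱼφ)` vanishes for all `θ` near `0`, so its derivative vanishes; the product rule
  -- then yields the formula.
  have h5 : HasFDerivAt (fun θ => inner ℝ (unitGradient f (c.param θ))
      (fderiv ℝ c.param θ (EuclideanSpace.single j 1)))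
      (0 : EuclideanSpace ℝ (Fin m) →L[ℝ] ℝ) 0 := by
    refine (hasFDerivAt_const (0 : ℝ) 0).congr_of_eventuallyEq ?_
    have hd : ∀ᶠ θ in 𝓝 0, ContDiffAt ℝ 2 c.param θ := c.contDiffAt_param.eventually (by simp)
    filter_upwards [c.eventually_param_mem.eventually_nhds, hd,
      c.hasFDerivAt_param.continuousAt.eventually_mem (hf.isOpen.mem_nhds
        (by rwa [c.param_zero]))] with θ h1 h2 h3
    exact hf.inner_unitGradient_eq_zero (h2.differentiableAt (by norm_num)).hasFDerivAt h1 h3 _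
  have h6 := congrArg (fun A : EuclideanSpace ℝ (Fin m) →L[ℝ] ℝ => A (EuclideanSpace.single i 1))
    (h3.unique h5)
  simp only [ContinuousLinearMap.comp_apply, ContinuousLinearMap.prod_apply,
    fderivInnerCLM_apply, c.param_zero] at h6
  rw [secondForm, Matrix.of_apply, tau2_eq, real_inner_comm]
  simp only [tau]
  simp at h6
  linarith

/-- The Weingarten tensor is minus the derivative of the normal on tangent vectors. -/
lemma weingarten_fderiv_param (c : C2Chart S p) (hf : IsDefiningFunction Ω S W f) (hpW : p ∈ W)
    (hν : ∀ i, inner ℝ (c.tau i) (unitGradient f p) = 0) (θ : EuclideanSpace ℝ (Fin m)) :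
    c.weingarten (unitGradient f p) (fderiv ℝ c.param 0 θ) =
      -fderiv ℝ (unitGradient f) p (fderiv ℝ c.param 0 θ) := by
  have key : ∀ j, c.weingarten (unitGradient f p) (c.tau j) =
      -fderiv ℝ (unitGradient f) p (c.tau j) := by
    intro j
    rw [← sub_eq_zero, sub_neg_eq_add]
    -- The difference `u` is orthogonal to each `τₖ` by `secondForm_eq` and to the normal since both
    -- terms are tangent, hence zero.
    set u := c.weingarten (unitGradient f p) (c.tau j) + fderiv ℝ (unitGradient f) p (c.tau j)
      with hu
    have h1 : ∀ k, inner ℝ (c.tau k) u = 0 := by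
      intro k
      rw [hu, inner_add_right, weingarten_tau, inner_sum]
      have h2 := c.secondForm_eq hf hpW j k
      rw [secondForm_symm] at h2
      simp only [real_inner_comm _ (c.tau k), inner_smul_left, inner_dualTau_tau, mul_ite,
        mul_one, mul_zero, Finset.sum_ite_eq', Finset.mem_univ, if_true, conj_trivial]
      linarith
    have h3 : inner ℝ (unitGradient f p) u = 0 := by
      rw [hu, inner_add_right, c.inner_normal_weingarten hν, hf.inner_fderiv_unitGradient hpW,
        add_zero]
    obtain ⟨r, hr⟩ := c.exists_smul_of_orthogonal (hf.norm_unitGradient hpW) hν h1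
    rw [hr, inner_smul_right, real_inner_self_eq_norm_sq, hf.norm_unitGradient hpW] at h3
    rw [hr, show r = 0 by linarith, zero_smul]
  simp only [c.fderiv_param_apply, map_sum, map_smul, key, smul_neg, Finset.sum_neg_distrib]

end C2Chart

/-! ### The derivative of the projection. -/

namespace IsRegularDomain

variable {a : ℝ} {W : Set (E m)} {f : E m → ℝ}

/-- The right side does not involve the chart, so any chart may be used in the formulas for `Π'` and
the Hessian. -/
lemma weingarten_eq_neg_fderiv (hR : IsRegularDomain Ω S) (hf : IsDefiningFunction Ω S W f)
    (hp : p ∈ S) (hpW : p ∈ W) (c : C2Chart S p) {v : E m}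
    (hv : inner ℝ (normal Ω S p) v = 0) :
    c.weingarten (normal Ω S p) v = -fderiv ℝ (unitGradient f) p v := by
  have hn := hR.isOuterUnitNormal_normal hp
  obtain ⟨θ, rfl⟩ := c.exists_fderiv_param_eq hn.norm_eq (hn.orthogonal c) hv
  have hnp := hR.normal_eq_unitGradient hf hp hpW
  have ho := hn.orthogonal c
  rw [hnp] at ho ⊢
  exact c.weingarten_fderiv_param hf hpW ho θ

/-- The range of `L` is tangent, so a kernel vector is tangent; there `L = -N'` and
`eq_zero_of_add_smul_fderiv` applies. -/
lemma isUnit_id_sub_weingarten (hR : IsRegularDomain Ω S) (ha : 0 < a)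
    (hB : UniformBallCondition Ω S a) (hp : p ∈ S) (c : C2Chart S p) {r : ℝ}
    (hr : r ∈ Ioo (-a) a) :
    IsUnit (ContinuousLinearMap.id ℝ (E m) - r • c.weingarten (normal Ω S p)) := by
  obtain ⟨W, f, hpW, hf⟩ := hR.exists_definingFunction p hp
  have hn := hR.isOuterUnitNormal_normal hp
  set A := ContinuousLinearMap.id ℝ (E m) - r • c.weingarten (normal Ω S p) with hA
  have hinj : Function.Injective A := by
    rw [injective_iff_map_eq_zero]
    intro v hv
    have hv' : v - r • c.weingarten (normal Ω S p) v = 0 := by simpa [hA] using hv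
    have h1 : inner ℝ (normal Ω S p) v = 0 := by
      have := congrArg (fun w => inner ℝ (normal Ω S p) w) hv'
      simpa [inner_sub_right, inner_smul_right, c.inner_normal_weingarten (hn.orthogonal c)]
        using this
    rw [hR.weingarten_eq_neg_fderiv hf hp hpW c h1, smul_neg, sub_neg_eq_add] at hv'
    exact hR.eq_zero_of_add_smul_fderiv ha hB hf hp hpW hr h1 hv'
  rw [ContinuousLinearMap.isUnit_iff_bijective]
  exact ⟨hinj, LinearMap.injective_iff_surjective (f := A.toLinearMap).1 hinj⟩

/-- The derivative of the nearest point projection. -/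
lemma fderiv_proj_eq (hR : IsRegularDomain Ω S) (ha : 0 < a) (hB : UniformBallCondition Ω S a)
    {x : E m} (hx : x ∈ tube Ω S a) (c : C2Chart S (proj S x)) :
    fderiv ℝ (proj S) x = tangentProj (normal Ω S (proj S x)) ∘L
      M0 (c.weingarten (normal Ω S (proj S x))) (signedDist Ω S x) := by
  obtain ⟨hp, hr, -⟩ := hR.tubeMap_proj_signedDist ha hB hx
  obtain ⟨W, f, hpW, hf⟩ := hR.exists_definingFunction _ hp
  have hn := hR.isOuterUnitNormal_normal hp
  set ν := normal Ω S (proj S x)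
  set L := c.weingarten ν with hL
  set r := signedDist Ω S x
  have hu := hR.isUnit_id_sub_weingarten ha hB hp c hr
  have hPapp : ∀ v, tangentProj ν v = v - inner ℝ ν v • ν := fun v => by
    simp [tangentProj, InnerProductSpace.rankOne_apply]
  have hLν : L ν = 0 := c.weingarten_normal (hn.orthogonal c)
  have hνL : ∀ v, inner ℝ ν (L v) = 0 := c.inner_normal_weingarten (hn.orthogonal c)
  have h1 : (ContinuousLinearMap.id ℝ (E m) - r • L) * fderiv ℝ (proj S) x = tangentProj ν := by
    refine ContinuousLinearMap.ext fun h => ?_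
    have hd := hR.decomposition ha hB hf hx hpW h
    rw [hR.fderiv_signedDist ha hB hx, InnerProductSpace.toDual_apply_apply] at hd
    have hw := hR.weingarten_eq_neg_fderiv hf hp hpW c (hR.inner_normal_fderiv_proj ha hB hx h)
    rw [hPapp, mul_apply_eq_comp]
    simp only [sub_apply, ContinuousLinearMap.id_apply, smul_apply]
    rw [hL, hw, smul_neg, sub_neg_eq_add, eq_sub_iff_add_eq, add_assoc]
    exact hd.symm
  -- `Lν = 0` and `ν` is orthogonal to the range of `L`, so `P` commutes with `I - rL`. This puts
  -- the inverse to the right of `P`.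
  have h2 : (ContinuousLinearMap.id ℝ (E m) - r • L) * tangentProj ν =
      tangentProj ν * (ContinuousLinearMap.id ℝ (E m) - r • L) := by
    refine ContinuousLinearMap.ext fun h => ?_
    simp only [mul_apply_eq_comp, hPapp, sub_apply, ContinuousLinearMap.id_apply,
      smul_apply, map_sub, map_smul, hLν, inner_sub_right, inner_smul_right, hνL]
    simp
  have h3 : (ContinuousLinearMap.id ℝ (E m) - r • L) *
      Ring.inverse (ContinuousLinearMap.id ℝ (E m) - r • L) = 1 := Ring.mul_inverse_cancel _ hu
  change _ = tangentProj ν * M0 L r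
  rw [M0]
  apply hu.mul_left_cancel
  rw [h1, ← mul_assoc, h2, mul_assoc, h3, mul_one]

end IsRegularDomain

/-! ### Principal curvatures as eigenvalues of the Weingarten tensor. -/

namespace C2Chart

lemma linearIndependent_tau_normal (c : C2Chart S p) {ν : E m} (hν1 : ‖ν‖ = 1)
    (hν : ∀ i, inner ℝ (c.tau i) ν = 0) :
    LinearIndependent ℝ (Sum.elim c.tau fun _ : Unit => ν) := by
  rw [Fintype.linearIndependent_iff]
  intro g hg
  rw [Fintype.sum_sum_type] at hg
  simp only [Sum.elim_inl, Sum.elim_inr, Finset.univ_unique, Finset.sum_singleton] at hg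
  have h1 : g (Sum.inr default) = 0 := by
    have h := congrArg (fun w => inner ℝ w ν) hg
    simpa [inner_add_left, sum_inner, inner_smul_left, hν, hν1] using h
  rw [h1, zero_smul, add_zero] at hg
  rintro (i | i)
  · exact Fintype.linearIndependent_iff.1 c.linearIndependent_tau _ hg i
  · exact h1

/-- The characteristic polynomials of the Weingarten tensor and of the shape matrix. -/
lemma charpoly_weingarten (c : C2Chart S p) {ν : E m} (hν1 : ‖ν‖ = 1)
    (hν : ∀ i, inner ℝ (c.tau i) ν = 0) :
    (c.weingarten ν).toLinearMap.charpoly = (c.shapeMatrix ν).charpoly * Polynomial.X := by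
  set b := basisOfLinearIndependentOfCardEqFinrank (c.linearIndependent_tau_normal hν1 hν)
    (by simp) with hb
  have hinl : ∀ i, b (Sum.inl i) = c.tau i := fun i => by simp [hb]
  have hinr : ∀ i, b (Sum.inr i) = ν := fun i => by simp [hb]
  -- In the basis `(τ, ν)` the `1 × 1` zero block belongs to `ν` and contributes the factor `X`.
  have hM : LinearMap.toMatrix b b (c.weingarten ν).toLinearMap =
      Matrix.fromBlocks (c.shapeMatrix ν) 0 0 0 := by
    rw [← LinearEquiv.eq_symm_apply, LinearMap.toMatrix_symm]
    refine b.ext ?_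
    rintro (i | i)
    · rw [Matrix.toLin_self, Fintype.sum_sum_type]
      simp [hinl, c.weingarten_tau_eq_shapeMatrix]
    · rw [Matrix.toLin_self, Fintype.sum_sum_type]
      simp [hinr, c.weingarten_normal hν]
  rw [← LinearMap.charpoly_toMatrix _ b, hM, Matrix.charpoly_fromBlocks_zero₁₂]
  simp [Matrix.charpoly_zero]

/-- The spectrum of the Weingarten tensor consists of the principal curvatures and `0`. -/
lemma exists_eigenbasis (c : C2Chart S p) {ν : E m} (hν1 : ‖ν‖ = 1)
    (hν : ∀ i, inner ℝ (c.tau i) ν = 0) :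
    ∃ (b : OrthonormalBasis (Fin (m + 1)) ℝ (E m)) (μ : Fin (m + 1) → ℝ),
      (∀ i, c.weingarten ν (b i) = μ i • b i) ∧
      Finset.univ.val.map μ = 0 ::ₘ c.principalCurvatures ν ∧
      (c.shapeMatrix ν).charpoly.Splits := by
  have hsymm := c.weingarten_isSymmetric ν
  have hfin : finrank ℝ (E m) = m + 1 := by simp
  set b := hsymm.eigenvectorBasis hfin
  set μ := hsymm.eigenvalues hfin
  have hbμ : ∀ i, c.weingarten ν (b i) = μ i • b i := fun i => hsymm.apply_eigenvectorBasis hfin i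
  have hM : LinearMap.toMatrix b.toBasis b.toBasis (c.weingarten ν).toLinearMap =
      Matrix.diagonal μ := by
    rw [← LinearEquiv.eq_symm_apply, LinearMap.toMatrix_symm]
    refine b.toBasis.ext fun i => ?_
    rw [Matrix.toLin_self]
    simp [hbμ, Matrix.diagonal_apply]
  -- `K` need not be symmetric. Its characteristic polynomial splits over `ℝ` because it divides
  -- that of the symmetric operator `L`.
  have hch : (c.shapeMatrix ν).charpoly * Polynomial.X =
      ∏ i, (Polynomial.X - Polynomial.C (μ i)) := by
    rw [← c.charpoly_weingarten hν1 hν, ← LinearMap.charpoly_toMatrix _ b.toBasis, hM,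
      Matrix.charpoly_diagonal]
  have hne : (c.shapeMatrix ν).charpoly * Polynomial.X ≠ 0 :=
    mul_ne_zero (Matrix.charpoly_monic _).ne_zero Polynomial.X_ne_zero
  refine ⟨b, μ, hbμ, ?_, ?_⟩
  · have hprod : ∏ i, (Polynomial.X - Polynomial.C (μ i)) =
        ((Finset.univ.val.map μ).map fun t => Polynomial.X - Polynomial.C t).prod := by
      rw [Multiset.map_map]
      rfl
    have h := congrArg Polynomial.roots (hch.trans hprod)
    rw [Polynomial.roots_mul hne, Polynomial.roots_X, Polynomial.roots_multiset_prod_X_sub_C] at h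
    rw [← h, add_comm, Multiset.singleton_add]
    rfl
  · refine Polynomial.Splits.of_dvd ?_ hne (dvd_mul_right _ _)
    rw [hch]
    exact Polynomial.Splits.prod fun i _ => Polynomial.Splits.X_sub_C _

lemma card_principalCurvatures (c : C2Chart S p) {ν : E m} (hν1 : ‖ν‖ = 1)
    (hν : ∀ i, inner ℝ (c.tau i) ν = 0) : (c.principalCurvatures ν).card = m := by
  obtain ⟨-, -, -, -, h⟩ := c.exists_eigenbasis hν1 hν
  rw [principalCurvatures, Polynomial.splits_iff_card_roots.1 h, Matrix.charpoly_natDegree_eq_dim,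
    Fintype.card_fin]

lemma meanCurvature_eq_sum (c : C2Chart S p) {ν : E m} (hν1 : ‖ν‖ = 1)
    (hν : ∀ i, inner ℝ (c.tau i) ν = 0) :
    c.meanCurvature ν = (c.principalCurvatures ν).sum := by
  obtain ⟨-, -, -, -, h⟩ := c.exists_eigenbasis hν1 hν
  exact Matrix.trace_eq_sum_roots_charpoly_of_splits h

end C2Chart

/-! ### Hessian and Laplacian of the signed distance. -/

namespace IsRegularDomain

variable {a : ℝ}

lemma one_sub_mul_eigenvalue_ne_zero (hR : IsRegularDomain Ω S) (ha : 0 < a)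
    (hB : UniformBallCondition Ω S a) (hp : p ∈ S) (c : C2Chart S p) {r : ℝ}
    (hr : r ∈ Ioo (-a) a) {v : E m} (hv : v ≠ 0) {μ : ℝ}
    (hμ : c.weingarten (normal Ω S p) v = μ • v) : 1 - r * μ ≠ 0 := by
  intro h
  have hu := hR.isUnit_id_sub_weingarten ha hB hp c hr
  refine hv (((ContinuousLinearMap.isUnit_iff_bijective).1 hu).1 ?_)
  rw [map_zero]
  simp only [sub_apply, ContinuousLinearMap.id_apply, smul_apply, hμ, smul_smul]
  rw [show v - (r * μ) • v = (1 - r * μ) • v by rw [sub_smul, one_smul], h, zero_smul]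

lemma one_sub_mul_principalCurvature_ne_zero (hR : IsRegularDomain Ω S) (ha : 0 < a)
    (hB : UniformBallCondition Ω S a) (hp : p ∈ S) (c : C2Chart S p) {r : ℝ}
    (hr : r ∈ Ioo (-a) a) {κ : ℝ} (hκ : κ ∈ c.principalCurvatures (normal Ω S p)) :
    1 - r * κ ≠ 0 := by
  have hn := hR.isOuterUnitNormal_normal hp
  obtain ⟨b, μ, hb, hμ, -⟩ := c.exists_eigenbasis hn.norm_eq (hn.orthogonal c)
  have hmem : κ ∈ Finset.univ.val.map μ := hμ ▸ Multiset.mem_cons_of_mem hκ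
  obtain ⟨i, -, rfl⟩ := Multiset.mem_map.1 hmem
  exact hR.one_sub_mul_eigenvalue_ne_zero ha hB hp c hr (b.orthonormal.ne_zero i) (hb i)

/-- The Hessian of the signed distance. -/
lemma iteratedFDeriv_signedDist (hR : IsRegularDomain Ω S) (ha : 0 < a)
    (hB : UniformBallCondition Ω S a) {x : E m} (hx : x ∈ tube Ω S a)
    (c : C2Chart S (proj S x)) (h k : E m) :
    iteratedFDeriv ℝ 2 (signedDist Ω S) x ![h, k] =
      -inner ℝ (c.weingarten (normal Ω S (proj S x)) (fderiv ℝ (proj S) x h)) k := by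
  have hp := (hR.tubeMap_proj_signedDist ha hB hx).1
  obtain ⟨W, f, hpW, hf⟩ := hR.exists_definingFunction _ hp
  have h1 := (hf.hasFDerivAt_unitGradient hpW).comp x (hR.hasFDerivAt_proj_fderiv ha hB hx)
  have h2 := (innerSL ℝ : E m →L[ℝ] E m →L[ℝ] ℝ).hasFDerivAt.comp x h1
  have h3 := h2.congr_of_eventuallyEq (f₁ := fderiv ℝ (signedDist Ω S)) (by
    filter_upwards [(hR.isOpen_tube ha hB).mem_nhds hx,
      hR.eventually_normal_proj ha hB hf hx hpW] with y hy hyn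
    rw [hR.fderiv_signedDist ha hB hy, hyn]
    rfl)
  rw [iteratedFDeriv_two_apply, h3.fderiv,
    hR.weingarten_eq_neg_fderiv hf hp hpW c (hR.inner_normal_fderiv_proj ha hB hx h),
    inner_neg_left, neg_neg]
  rfl

lemma laplacian_signedDist (hR : IsRegularDomain Ω S) (ha : 0 < a)
    (hB : UniformBallCondition Ω S a) {x : E m} (hx : x ∈ tube Ω S a)
    (c : C2Chart S (proj S x)) :
    Laplacian.laplacian (signedDist Ω S) x =
      -((c.principalCurvatures (normal Ω S (proj S x))).map
        fun κ => κ / (1 - signedDist Ω S x * κ)).sum := by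
  obtain ⟨hp, hr, -⟩ := hR.tubeMap_proj_signedDist ha hB hx
  have hn := hR.isOuterUnitNormal_normal hp
  set ν := normal Ω S (proj S x) with hν
  set r := signedDist Ω S x
  obtain ⟨b, μ, hb, hμ, -⟩ := c.exists_eigenbasis hn.norm_eq (hn.orthogonal c)
  have hne : ∀ i, 1 - r * μ i ≠ 0 := fun i =>
    hR.one_sub_mul_eigenvalue_ne_zero ha hB hp c hr (b.orthonormal.ne_zero i) (hb i)
  have hu := hR.isUnit_id_sub_weingarten ha hB hp c hr
  have hM : ∀ i, M0 (c.weingarten ν) r (b i) = (1 - r * μ i)⁻¹ • b i := by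
    intro i
    have h1 : (ContinuousLinearMap.id ℝ (E m) - r • c.weingarten ν) ((1 - r * μ i)⁻¹ • b i) =
        b i := by
      simp only [map_smul, sub_apply, ContinuousLinearMap.id_apply, smul_apply, hb, smul_smul]
      rw [← one_smul ℝ (b i), smul_smul, mul_one, ← sub_smul, smul_smul, inv_mul_cancel₀ (hne i)]
    have h2 := congrArg (fun A : E m →L[ℝ] E m => A ((1 - r * μ i)⁻¹ • b i))
      (Ring.inverse_mul_cancel _ hu)
    simp only [mul_apply_eq_comp] at h2
    rw [← hν, h1] at h2
    exact h2
  have hterm : ∀ i, iteratedFDeriv ℝ 2 (signedDist Ω S) x ![b i, b i] =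
      -(μ i / (1 - r * μ i)) := by
    intro i
    rw [hR.iteratedFDeriv_signedDist ha hB hx c, hR.fderiv_proj_eq ha hB hx c,
      ContinuousLinearMap.comp_apply, ← hν, hM]
    -- `P` drops out here because `LP = L`, as `Lν = 0`.
    simp only [tangentProj, sub_apply, ContinuousLinearMap.id_apply,
      InnerProductSpace.rankOne_apply, map_sub, map_smul, c.weingarten_normal (hn.orthogonal c),
      hb, smul_zero, sub_zero, inner_smul_left, real_inner_self_eq_norm_sq, b.norm_eq_one]
    simp [div_eq_inv_mul]
  rw [congrFun (InnerProductSpace.laplacian_eq_iteratedFDeriv_orthonormalBasis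
    (signedDist Ω S) b) x]
  simp only [hterm, Finset.sum_neg_distrib]
  congr 1
  -- The extra eigenvalue `0` contributes `0 / 1 = 0` to the sum, leaving the principal curvatures.
  have h := congrArg (fun s : Multiset ℝ => (s.map fun κ => κ / (1 - r * κ)).sum) hμ
  simp only [Multiset.map_map, Multiset.map_cons, Multiset.sum_cons, zero_div, zero_add] at h
  exact h

lemma mem_tube_of_mem (ha : 0 < a) (hp : p ∈ S) : p ∈ tube Ω S a :=
  ⟨(p, 0), ⟨hp, by simpa using ha⟩, by simp [tubeMap]⟩

lemma proj_of_mem (hR : IsRegularDomain Ω S) (ha : 0 < a) (hB : UniformBallCondition Ω S a)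
    (hp : p ∈ S) : proj S p = p := by
  have h := hR.proj_tubeMap ha hB hp (r := 0) ⟨by linarith, ha⟩
  simpa [tubeMap] using h

lemma signedDist_of_mem (hp : p ∈ S) : signedDist Ω S p = 0 := by
  simp [signedDist, infDist_zero_of_mem hp]

lemma M0_zero (L : E m →L[ℝ] E m) : M0 L 0 = ContinuousLinearMap.id ℝ (E m) := by
  have h : ContinuousLinearMap.id ℝ (E m) - (0 : ℝ) • L = 1 :=
    ContinuousLinearMap.ext fun v => by simp
  rw [M0, h]
  exact Ring.inverse_one _

lemma hasFDerivAt_proj_of_mem (hR : IsRegularDomain Ω S) (ha : 0 < a)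
    (hB : UniformBallCondition Ω S a) (hp : p ∈ S) :
    HasFDerivAt (proj S) (tangentProj (normal Ω S p)) p := by
  have hx := mem_tube_of_mem (Ω := Ω) ha hp
  have hpr := hR.proj_of_mem ha hB hp
  have h := hR.hasFDerivAt_proj_fderiv ha hB hx
  obtain ⟨c⟩ := hR.isC2Hypersurface _ (hR.tubeMap_proj_signedDist ha hB hx).1
  rw [hR.fderiv_proj_eq ha hB hx c, signedDist_of_mem hp, M0_zero] at h
  rwa [ContinuousLinearMap.comp_id, hpr] at h

lemma meanCurvature_eq (hR : IsRegularDomain Ω S) (ha : 0 < a) (hB : UniformBallCondition Ω S a)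
    (hp : p ∈ S) (c : C2Chart S p) :
    c.meanCurvature (normal Ω S p) = -Laplacian.laplacian (signedDist Ω S) p := by
  have hx := mem_tube_of_mem (Ω := Ω) ha hp
  have hpr := hR.proj_of_mem ha hB hp
  have hn := hR.isOuterUnitNormal_normal hp
  -- The type of charts depends on the base point, and `proj S p = p` is not definitional;
  -- generalizing the point allows the rewrite.
  have key : ∀ q (_ : q = p) (c' : C2Chart S q), (∀ c'' : C2Chart S (proj S p),
      Laplacian.laplacian (signedDist Ω S) p =
      -((c''.principalCurvatures (normal Ω S (proj S p))).map
        fun κ => κ / (1 - signedDist Ω S p * κ)).sum) →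
      Laplacian.laplacian (signedDist Ω S) p =
      -((c'.principalCurvatures (normal Ω S q)).map
        fun κ => κ / (1 - signedDist Ω S p * κ)).sum := by
    rintro q rfl c' h
    rw [hpr] at h
    exact h c'
  rw [key p rfl c fun c'' => hR.laplacian_signedDist ha hB hx c'', neg_neg,
    c.meanCurvature_eq_sum hn.norm_eq (hn.orthogonal c), signedDist_of_mem hp]
  simp

end IsRegularDomain

end Chart

end Tube

end

open Tube in
theorem mainTheorem4 (m : ℕ) (S Ω : Set (E m))
    (hS_compact : IsCompact S) (hS_conn : IsConnected S) (hS : IsC2Hypersurface S)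
    (hΩ_open : IsOpen Ω) (hΩ_conn : IsConnected Ω) (hΩ_bdd : Bornology.IsBounded Ω)
    (hΩS : frontier Ω = S) :
    -- the outer unit normal field exists, and the uniform ball condition holds for some radius
    (∀ p ∈ S, IsOuterUnitNormal Ω S p (normal Ω S p)) ∧
    (∃ a : ℝ, 0 < a ∧ UniformBallCondition Ω S a) ∧
    ∀ a : ℝ, 0 < a → UniformBallCondition Ω S a →
      -- the tubular neighbourhood, with `(proj, signedDist)` the inverse of the map `X`
      IsOpen (tube Ω S a) ∧
      tube Ω S a = {x | Metric.infDist x S < a} ∧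
      Set.InjOn (tubeMap Ω S) (S ×ˢ Set.Ioo (-a) a) ∧
      (∀ x ∈ tube Ω S a,
        proj S x ∈ S ∧ signedDist Ω S x ∈ Set.Ioo (-a) a ∧
        tubeMap Ω S (proj S x, signedDist Ω S x) = x ∧
        ∀ q ∈ S, dist x q = Metric.infDist x S → q = proj S x) ∧
      -- regularity
      ContDiffOn ℝ 2 (signedDist Ω S) (tube Ω S a) ∧
      ContDiffOn ℝ 1 (proj S) (tube Ω S a) ∧
      -- the gradient of the signed distance
      (∀ x ∈ tube Ω S a,
        HasGradientAt (signedDist Ω S) (normal Ω S (proj S x)) x) ∧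
      -- the derivative of the projection
      (∀ x ∈ tube Ω S a, ∀ c : C2Chart S (proj S x),
        IsUnit (ContinuousLinearMap.id ℝ (E m) -
          signedDist Ω S x • c.weingarten (normal Ω S (proj S x))) ∧
        HasFDerivAt (proj S)
          (tangentProj (normal Ω S (proj S x)) ∘L
            M0 (c.weingarten (normal Ω S (proj S x))) (signedDist Ω S x)) x) ∧
      (∀ p ∈ S, HasFDerivAt (proj S) (tangentProj (normal Ω S p)) p) ∧
      -- the Laplacian of the signed distance; there are `n - 1 = m` principal curvatures
      (∀ x ∈ tube Ω S a, ∀ c : C2Chart S (proj S x),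
        (c.principalCurvatures (normal Ω S (proj S x))).card = m ∧
        (∀ κ ∈ c.principalCurvatures (normal Ω S (proj S x)), 1 - signedDist Ω S x * κ ≠ 0) ∧
        Laplacian.laplacian (signedDist Ω S) x =
          -((c.principalCurvatures (normal Ω S (proj S x))).map
            fun κ => κ / (1 - signedDist Ω S x * κ)).sum) ∧
      -- the mean curvature
      (∀ p ∈ S, ∀ c : C2Chart S p,
        c.meanCurvature (normal Ω S p) = -Laplacian.laplacian (signedDist Ω S) p) := by
  have hR : IsRegularDomain Ω S := ⟨hS_compact, hS_conn.nonempty, hS, hΩ_open, hΩS, fun p hp =>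
    exists_isDefiningFunction hS_conn hS hΩ_open hΩ_conn hΩ_bdd hΩS hp⟩
  refine ⟨fun p hp => hR.isOuterUnitNormal_normal hp, hR.exists_uniformBallCondition,
    fun a ha hB => ?_⟩
  refine ⟨hR.isOpen_tube ha hB, hR.tube_eq ha hB, hR.injOn_tubeMap ha hB, fun x hx => ?_,
    hR.contDiffOn_signedDist ha hB,
    fun x hx => (hR.contDiffAt_proj ha hB hx).contDiffWithinAt,
    fun x hx => hR.hasGradientAt_signedDist ha hB hx, fun x hx c => ?_,
    fun p hp => hR.hasFDerivAt_proj_of_mem ha hB hp, fun x hx c => ?_,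
    fun p hp c => hR.meanCurvature_eq ha hB hp c⟩
  · obtain ⟨hp, hr, htm⟩ := hR.tubeMap_proj_signedDist ha hB hx
    refine ⟨hp, hr, htm, fun q hq hd => ?_⟩
    rw [← htm] at hd
    exact hR.eq_of_dist_tubeMap ha hB hp hq hr hd
  · obtain ⟨hp, hr, -⟩ := hR.tubeMap_proj_signedDist ha hB hx
    refine ⟨hR.isUnit_id_sub_weingarten ha hB hp c hr, ?_⟩
    rw [← hR.fderiv_proj_eq ha hB hx c]
    exact hR.hasFDerivAt_proj_fderiv ha hB hx
  · obtain ⟨hp, hr, -⟩ := hR.tubeMap_proj_signedDist ha hB hx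
    have hn := hR.isOuterUnitNormal_normal hp
    exact ⟨c.card_principalCurvatures hn.norm_eq (hn.orthogonal c),
      fun κ hκ => hR.one_sub_mul_principalCurvature_ne_zero ha hB hp c hr hκ,
      hR.laplacian_signedDist ha hB hx c⟩
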